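/- Let $W=(W_t)_{t\ge 0}$ be a standard Brownian motion and, for $\sigma>0$ and $0<v\le 1$, let $$\tilde\eta_v=\int_0^v \exp\{\sigma W_u-\sigma^2u/2\}\,du ,\qquad v_*=\min(\sigma^2 v,1).$$ Then $\tilde\eta_v$ has a Lebesgue density $q(v,\cdot)$ on $(0,\infty)$ which is differentiable in $z$ at every $z>0$ (and is hence the unique continuous version on $(0,\infty)$), and there are absolute constants $\tilde c>0$ and $\kappa>0$, independent of $\sigma$, $v$, $z$, such that the following hold. (i) For all $\sigma>0$, $0<v\le 1$, $z>0$, $$q(v,z)\le \frac{\tilde c\,\sigma^3}{v_*^2}\Bigl(\exp\Bigl\{-\frac{\kappa}{\sigma^2 v}\bigl(\ln (z/v)\bigr)^2\Bigr\}\mathbf 1_{\{z>v\}}+\mathbf 1_{\{z\le v\}}\Bigr).$$ (ii) For all $\sigma\ge 1$, $0<v\le 1$, $z>0$, $$|q_z(v,z)|\le \frac{\tilde c\,\sigma^7}{v_*^4}\Bigl(\exp\Bigl\{-\frac{\kappa}{\sigma^2 v}\bigl(\ln (z/v)\bigr)^2\Bigr\}\mathbf 1_{\{z>v\}}+\mathbf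 1_{\{z\le v\}}\Bigr),$$ where $q_z=\partial q/\partial z$. For each $0<\sigma<1$ the bound in (ii) holds, with the same $\kappa$ and for all $0<v\le 1$, $z>0$, after replacing $\tilde c$ by a constant $C(\sigma)>0$ that depends only on $\sigma$. -/

import Mathlib

open MeasureTheory ProbabilityTheory
open scoped NNReal ENNReal

/-- The time integral `∫₀ᵛ exp (σ W_u - σ² u / 2) du` of the geometric Brownian motion driven
by the process `W` (indexed by times `u ≥ 0`). -/
noncomputable def expFunctional {Ω : Type*} (σ : ℝ) (W : ℝ≥0 → Ω → ℝ) (v : ℝ) (ω : Ω) : ℝ :=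
  ∫ u in (0 : ℝ)..v, Real.exp (σ * W u.toNNReal ω - σ ^ 2 * u / 2)

/-- `q` is, on `(0, ∞)`, a probability density with respect to Lebesgue measure of the random
variable `X`, whose law is carried by `(0, ∞)`. -/
structure IsDensityOnPos {Ω : Type*} [MeasurableSpace Ω] (P : Measure Ω) (X : Ω → ℝ)
    (q : ℝ → ℝ) : Prop where
  aemeasurable : AEMeasurable q (volume.restrict (Set.Ioi 0))
  nonneg : ∀ z : ℝ, 0 < z → 0 ≤ q z
  hasLaw : HasLaw X ((volume.restrict (Set.Ioi 0)).withDensity fun z => ENNReal.ofReal (q z)) P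

/-- The profile
`exp (-(κ / (σ² v)) (ln (z / v))²) 1_{z > v} + 1_{z ≤ v}`. -/
noncomputable def logTail (κ σ v z : ℝ) : ℝ :=
  (Set.Ioi v).indicator (fun y => Real.exp (-(κ / (σ ^ 2 * v)) * (Real.log (y / v)) ^ 2)) z
    + (Set.Iic v).indicator (fun _ => (1 : ℝ)) z

/-- `v_* = min (σ² v, 1)`. -/
noncomputable def vStar (σ v : ℝ) : ℝ := min (σ ^ 2 * v) 1

/-! Fix a horizon θ ≤ v with σ²θ ≤ 1 and split W_u = R_u + (min(u, θ)/θ) W_θ. The process R is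
jointly Gaussian with W_θ and uncorrelated with it, hence independent of it (`indepFun_bridgePart`).
With ξ = W_θ/√θ the functional is M_0(ξ), where M_n(x) = ∫₀ᵛ hⁿ exp(x h + G), h(u) = σ min(u, θ)/√θ
≤ σ√θ ≤ 1, and G(u) = σ R_u - σ²u/2 is independent of ξ. For frozen G, M_0 is a smooth increasing
bijection from ℝ onto (0, ∞), so M_0(ξ) has density φ(x)/M_1(x) at z = M_0(x), with an explicit
z-derivative. Averaging over G gives q and its derivative (`map_tiltMoment`,
`averagedTiltDensity_bounds`).

Size: M_1(x) ≥ exp(-|x|) J with J = ∫₀^θ h exp(G). The Gaussian factor absorbs the powers of exp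
|x|, and Jensen's inequality bounds E J^(-k) by a constant times H^(-k), where H = ∫₀^θ h = σ
θ^(3/2)/2 (`inv_tiltMoment_pow`).

Tail: let z > v, l = log(z/v) and ε = exp(-l²/(16σ²v)). Either ∫₀ᵛ exp(G) < v exp(l/2), which forces
|x| > l/(2σ√θ) and makes exp(-x²/4) ≤ ε, or an event of probability at most ε² occurs
(`measureReal_le`). A weighted AM-GM inequality on that event still leaves one factor ε
(`integral_le_of_le`).

Finally θ = min(v, σ⁻²), so that v_* = σ²θ. -/

/-! ### Exponential tilts of a positive function -/

/-- A continuous direction `h`, positive on `(0, ∞)` and bounded by `s`. -/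
structure IsTilt (h : ℝ → ℝ) (s : ℝ) : Prop where
  continuous : Continuous h
  nonneg : ∀ u, 0 ≤ u → 0 ≤ h u
  pos : ∀ u, 0 < u → 0 < h u
  le : ∀ u, h u ≤ s

/-- The `n`-th derivative in `x` of `∫₀ᵛ exp (x h + G)`. -/
noncomputable def tiltMoment (h G : ℝ → ℝ) (v : ℝ) (n : ℕ) (x : ℝ) : ℝ :=
  ∫ u in (0 : ℝ)..v, h u ^ n * Real.exp (h u * x + G u)

namespace IsTilt

variable {h G : ℝ → ℝ} {s v : ℝ}

lemma intervalIntegrable (hh : IsTilt h s) (hG : Continuous G) (n : ℕ) (x a b : ℝ) :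
    IntervalIntegrable (fun u => h u ^ n * Real.exp (h u * x + G u)) volume a b := by
  have := hh.continuous
  exact Continuous.intervalIntegrable (by fun_prop) _ _

lemma tiltMoment_pos (hh : IsTilt h s) (hG : Continuous G) (hv : 0 < v) (n : ℕ) (x : ℝ) :
    0 < tiltMoment h G v n x :=
  intervalIntegral.intervalIntegral_pos_of_pos_on (hh.intervalIntegrable hG n x 0 v)
    (fun u hu => mul_pos (pow_pos (hh.pos u hu.1) n) (Real.exp_pos _)) hv

lemma tiltMoment_succ_le (hh : IsTilt h s) (hs : s ≤ 1) (hG : Continuous G) (hv : 0 < v)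
    (n : ℕ) (x : ℝ) : tiltMoment h G v (n + 1) x ≤ tiltMoment h G v n x := by
  refine intervalIntegral.integral_mono_on hv.le (hh.intervalIntegrable hG _ x 0 v)
    (hh.intervalIntegrable hG _ x 0 v) fun u hu => ?_
  have h0 := hh.nonneg u hu.1
  have h1 : h u ≤ 1 := (hh.le u).trans hs
  exact mul_le_mul_of_nonneg_right (pow_le_pow_of_le_one h0 h1 (Nat.le_succ n))
    (Real.exp_pos _).le

lemma hasDerivAt_tiltMoment (hh : IsTilt h s) (hs : s ≤ 1) (hG : Continuous G) (hv : 0 < v)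
    (n : ℕ) (x : ℝ) :
    HasDerivAt (tiltMoment h G v n) (tiltMoment h G v (n + 1) x) x := by
  have hc := hh.continuous
  refine (intervalIntegral.hasDerivAt_integral_of_dominated_loc_of_deriv_le
    (F := fun x u => h u ^ n * Real.exp (h u * x + G u))
    (F' := fun x u => h u ^ (n + 1) * Real.exp (h u * x + G u))
    (bound := fun u => Real.exp (|x| + 1 + G u)) (Metric.ball_mem_nhds x one_pos)
    (Filter.Eventually.of_forall fun y => ?_) (hh.intervalIntegrable hG n x 0 v) ?_
    (Filter.Eventually.of_forall fun u hu y hy => ?_) ?_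
    (Filter.Eventually.of_forall fun u hu y hy => ?_)).2
  · exact Continuous.aestronglyMeasurable (by fun_prop)
  · exact Continuous.aestronglyMeasurable (by fun_prop)
  · rw [Set.uIoc_of_le hv.le] at hu
    have h0 := hh.nonneg u hu.1.le
    have h1 : h u ≤ 1 := (hh.le u).trans hs
    have hy' : |y| ≤ |x| + 1 := by
      have h2 := abs_sub_abs_le_abs_sub y x
      rw [Metric.mem_ball, Real.dist_eq] at hy
      linarith
    rw [Real.norm_eq_abs, abs_of_nonneg (by positivity)]
    have h3 : h u * y ≤ |x| + 1 :=
      calc h u * y ≤ h u * |y| := mul_le_mul_of_nonneg_left (le_abs_self y) h0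
        _ ≤ 1 * |y| := mul_le_mul_of_nonneg_right h1 (abs_nonneg y)
        _ ≤ |x| + 1 := by linarith
    calc h u ^ (n + 1) * Real.exp (h u * y + G u)
        ≤ 1 * Real.exp (|x| + 1 + G u) := by
          gcongr
          exact pow_le_one₀ h0 h1
      _ = _ := one_mul _
  · exact Continuous.intervalIntegrable (by fun_prop) _ _
  · have h4 : HasDerivAt (fun y => h u * y + G u) (h u) y := by
      simpa using ((hasDerivAt_id y).const_mul (h u)).add_const (G u)
    refine (h4.exp.const_mul (h u ^ n)).congr_deriv ?_
    ring

lemma continuous_tiltMoment (hh : IsTilt h s) (hs : s ≤ 1) (hG : Continuous G) (hv : 0 < v)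
    (n : ℕ) : Continuous (tiltMoment h G v n) :=
  continuous_iff_continuousAt.2 fun x => (hh.hasDerivAt_tiltMoment hs hG hv n x).continuousAt

lemma strictMono_tiltMoment (hh : IsTilt h s) (hs : s ≤ 1) (hG : Continuous G) (hv : 0 < v)
    (n : ℕ) : StrictMono (tiltMoment h G v n) :=
  strictMono_of_deriv_pos fun x => by
    rw [(hh.hasDerivAt_tiltMoment hs hG hv n x).deriv]
    exact hh.tiltMoment_pos hG hv _ x

/-- From exp(h x) ≥ h x one gets the linear minorant x M_1(0), with positive slope. -/
lemma tendsto_tiltMoment_atTop (hh : IsTilt h s) (hG : Continuous G) (hv : 0 < v) :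
    Filter.Tendsto (tiltMoment h G v 0) Filter.atTop Filter.atTop := by
  have h1 := hh.tiltMoment_pos hG hv 1 0
  refine Filter.tendsto_atTop_mono (f := fun x => x * tiltMoment h G v 1 0) (fun x => ?_)
    (Filter.tendsto_id.atTop_mul_const h1)
  simp only [tiltMoment]
  rw [← intervalIntegral.integral_const_mul]
  refine intervalIntegral.integral_mono_on hv.le
    ((hh.intervalIntegrable hG 1 0 0 v).const_mul x) (hh.intervalIntegrable hG 0 x 0 v)
    fun u _ => ?_
  rw [mul_zero, zero_add, Real.exp_add, pow_zero, one_mul, pow_one, ← mul_assoc]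
  refine mul_le_mul_of_nonneg_right ?_ (Real.exp_pos _).le
  linarith [Real.add_one_le_exp (h u * x)]

/-- Dominated convergence, with dominating function exp(G) once x ≤ 0. The point u = 0, where h may
vanish, does not lie in the half-open interval of integration. -/
lemma tendsto_tiltMoment_atBot (hh : IsTilt h s) (hG : Continuous G) (hv : 0 < v) :
    Filter.Tendsto (tiltMoment h G v 0) Filter.atBot (nhds 0) := by
  have hc := hh.continuous
  have h0 : (0 : ℝ) = ∫ _ in (0 : ℝ)..v, (0 : ℝ) := by simp
  rw [h0]
  refine intervalIntegral.tendsto_integral_filter_of_dominated_convergence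
    (fun u => Real.exp (G u)) (Filter.Eventually.of_forall fun y => ?_) ?_ ?_
    (Filter.Eventually.of_forall fun u hu => ?_)
  · exact Continuous.aestronglyMeasurable (by fun_prop)
  · filter_upwards [Filter.eventually_le_atBot 0] with y hy
    refine Filter.Eventually.of_forall fun u hu => ?_
    rw [Set.uIoc_of_le hv.le] at hu
    rw [Real.norm_eq_abs, pow_zero, one_mul, Real.abs_exp]
    have := mul_nonpos_of_nonneg_of_nonpos (hh.nonneg u hu.1.le) hy
    exact Real.exp_le_exp.2 (by linarith)
  · exact Continuous.intervalIntegrable (by fun_prop) _ _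
  · rw [Set.uIoc_of_le hv.le] at hu
    simp only [pow_zero, one_mul]
    refine Real.tendsto_exp_atBot.comp ?_
    exact Filter.tendsto_atBot_add_const_right _ _
      (Filter.tendsto_id.const_mul_atBot (hh.pos u hu.1))

lemma exists_tiltMoment_eq (hh : IsTilt h s) (hs : s ≤ 1) (hG : Continuous G) (hv : 0 < v)
    {z : ℝ} (hz : 0 < z) : ∃ x, tiltMoment h G v 0 x = z := by
  obtain ⟨a, ha⟩ := ((hh.tendsto_tiltMoment_atBot hG hv).eventually_lt_const hz).exists
  obtain ⟨b, hb⟩ := ((hh.tendsto_tiltMoment_atTop hG hv).eventually_gt_atTop z).exists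
  exact mem_range_of_exists_le_of_exists_ge (hh.continuous_tiltMoment hs hG hv 0)
    ⟨a, ha.le⟩ ⟨b, hb.le⟩

lemma tiltMoment_zero_le (hh : IsTilt h s) (hG : Continuous G) (hv : 0 < v) (x : ℝ) :
    tiltMoment h G v 0 x ≤ Real.exp (s * |x|) * ∫ u in (0 : ℝ)..v, Real.exp (G u) := by
  rw [tiltMoment, ← intervalIntegral.integral_const_mul]
  refine intervalIntegral.integral_mono_on hv.le (hh.intervalIntegrable hG 0 x 0 v)
    (Continuous.intervalIntegrable (by fun_prop) _ _) fun u hu => ?_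
  rw [pow_zero, one_mul, Real.exp_add]
  refine mul_le_mul_of_nonneg_right (Real.exp_le_exp.2 ?_) (Real.exp_pos _).le
  exact (mul_le_mul_of_nonneg_left (le_abs_self x) (hh.nonneg u hu.1)).trans
    (mul_le_mul_of_nonneg_right (hh.le u) (abs_nonneg x))

/-- Separates x from G: the remaining integral over [0, θ] depends on G only, and its negative
moments can be estimated independently of z. -/
lemma le_tiltMoment_one (hh : IsTilt h s) (hs : s ≤ 1) (hG : Continuous G) {θ : ℝ} (hθ : 0 < θ)
    (hθv : θ ≤ v) (x : ℝ) :
    Real.exp (-|x|) * ∫ u in (0 : ℝ)..θ, h u * Real.exp (G u) ≤ tiltMoment h G v 1 x := by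
  have hc := hh.continuous
  have h1 : Real.exp (-|x|) * ∫ u in (0 : ℝ)..θ, h u * Real.exp (G u) ≤
      tiltMoment h G θ 1 x := by
    rw [tiltMoment, ← intervalIntegral.integral_const_mul]
    refine intervalIntegral.integral_mono_on hθ.le
      (Continuous.intervalIntegrable (by fun_prop) _ _) (hh.intervalIntegrable hG 1 x 0 θ)
      fun u hu => ?_
    rw [Real.exp_add, pow_one, mul_left_comm]
    refine mul_le_mul_of_nonneg_left ?_ (hh.nonneg u hu.1)
    refine mul_le_mul_of_nonneg_right (Real.exp_le_exp.2 ?_) (Real.exp_pos _).le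
    have h2 : |h u * x| ≤ |x| := by
      rw [abs_mul, abs_of_nonneg (hh.nonneg u hu.1)]
      exact mul_le_of_le_one_left (abs_nonneg x) ((hh.le u).trans hs)
    linarith [neg_abs_le (h u * x)]
  refine h1.trans (intervalIntegral.integral_mono_interval le_rfl hθ.le hθv ?_
    (hh.intervalIntegrable hG 1 x 0 v))
  filter_upwards [ae_restrict_mem measurableSet_Ioc] with u hu
  exact mul_nonneg (pow_nonneg (hh.nonneg u hu.1.le) 1) (Real.exp_pos _).le

end IsTilt

/-! ### The inverse of the tilted integral and the conditional density -/

/-- The solution `x` of `∫₀ᵛ exp (x h + G) = z`, for `z > 0`. -/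
noncomputable def tiltInv (h G : ℝ → ℝ) (v z : ℝ) : ℝ :=
  if 0 < z then Function.invFun (tiltMoment h G v 0) z else 0

/-- The density at `z` of `∫₀ᵛ exp (X h + G)` for a standard normal variable `X`. -/
noncomputable def tiltDensity (h G : ℝ → ℝ) (v z : ℝ) : ℝ :=
  gaussianPDFReal 0 1 (tiltInv h G v z) / tiltMoment h G v 1 (tiltInv h G v z)

/-- The derivative of `tiltDensity` in `z`. -/
noncomputable def tiltDensityDeriv (h G : ℝ → ℝ) (v z : ℝ) : ℝ :=
  -gaussianPDFReal 0 1 (tiltInv h G v z) *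
    (tiltInv h G v z / tiltMoment h G v 1 (tiltInv h G v z) ^ 2
      + tiltMoment h G v 2 (tiltInv h G v z) / tiltMoment h G v 1 (tiltInv h G v z) ^ 3)

lemma hasDerivAt_gaussianPDFReal_standard (x : ℝ) :
    HasDerivAt (gaussianPDFReal 0 1) (-x * gaussianPDFReal 0 1 x) x := by
  have h1 : HasDerivAt (fun y : ℝ => -y ^ 2 / 2) (-x) x := by
    refine (((hasDerivAt_pow 2 x).neg).div_const 2).congr_deriv ?_
    norm_num
    ring
  have h2 := h1.exp.const_mul (√(2 * Real.pi))⁻¹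
  have h3 : gaussianPDFReal 0 1 = fun y : ℝ => (√(2 * Real.pi))⁻¹ * Real.exp (-y ^ 2 / 2) := by
    ext y
    simp [gaussianPDFReal]
  rw [h3]
  refine h2.congr_deriv ?_
  ring

lemma gaussianPDFReal_standard_le (x : ℝ) : gaussianPDFReal 0 1 x ≤ Real.exp (-x ^ 2 / 2) := by
  have h3 : gaussianPDFReal 0 1 x = (√(2 * Real.pi))⁻¹ * Real.exp (-x ^ 2 / 2) := by
    simp [gaussianPDFReal]
  rw [h3]
  refine mul_le_of_le_one_left (Real.exp_pos _).le (inv_le_one_of_one_le₀ ?_)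
  rw [Real.one_le_sqrt]
  linarith [Real.pi_gt_three]

namespace IsTilt

variable {h G : ℝ → ℝ} {s v : ℝ}

lemma tiltMoment_tiltInv (hh : IsTilt h s) (hs : s ≤ 1) (hG : Continuous G) (hv : 0 < v)
    {z : ℝ} (hz : 0 < z) : tiltMoment h G v 0 (tiltInv h G v z) = z := by
  rw [tiltInv, if_pos hz]
  exact Function.invFun_eq (hh.exists_tiltMoment_eq hs hG hv hz)

lemma tiltInv_tiltMoment (hh : IsTilt h s) (hs : s ≤ 1) (hG : Continuous G) (hv : 0 < v)
    (x : ℝ) : tiltInv h G v (tiltMoment h G v 0 x) = x :=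
  (hh.strictMono_tiltMoment hs hG hv 0).injective
    (hh.tiltMoment_tiltInv hs hG hv (hh.tiltMoment_pos hG hv 0 x))

/-- A strictly increasing function on (0, ∞) whose image is all of ℝ has no jumps. -/
lemma continuousAt_tiltInv (hh : IsTilt h s) (hs : s ≤ 1) (hG : Continuous G) (hv : 0 < v)
    {z : ℝ} (hz : 0 < z) : ContinuousAt (tiltInv h G v) z := by
  have hm : StrictMonoOn (tiltInv h G v) (Set.Ioi 0) := fun a ha b hb hab => by
    rw [← (hh.strictMono_tiltMoment hs hG hv 0).lt_iff_lt, hh.tiltMoment_tiltInv hs hG hv ha,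
      hh.tiltMoment_tiltInv hs hG hv hb]
    exact hab
  refine hm.continuousAt_of_image_mem_nhds (Ioi_mem_nhds hz) ?_
  have : tiltInv h G v '' Set.Ioi 0 = Set.univ := Set.eq_univ_of_forall fun x =>
    ⟨tiltMoment h G v 0 x, hh.tiltMoment_pos hG hv 0 x, hh.tiltInv_tiltMoment hs hG hv x⟩
  rw [this]
  exact Filter.univ_mem

lemma hasDerivAt_tiltInv (hh : IsTilt h s) (hs : s ≤ 1) (hG : Continuous G) (hv : 0 < v)
    {z : ℝ} (hz : 0 < z) :
    HasDerivAt (tiltInv h G v) (tiltMoment h G v 1 (tiltInv h G v z))⁻¹ z :=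
  HasDerivAt.of_local_left_inverse (hh.continuousAt_tiltInv hs hG hv hz)
    (hh.hasDerivAt_tiltMoment hs hG hv 0 _) (hh.tiltMoment_pos hG hv 1 _).ne'
    (by filter_upwards [Ioi_mem_nhds hz] with y hy using hh.tiltMoment_tiltInv hs hG hv hy)

lemma hasDerivAt_tiltDensity (hh : IsTilt h s) (hs : s ≤ 1) (hG : Continuous G) (hv : 0 < v)
    {z : ℝ} (hz : 0 < z) :
    HasDerivAt (tiltDensity h G v) (tiltDensityDeriv h G v z) z := by
  have hM := (hh.tiltMoment_pos hG hv 1 (tiltInv h G v z)).ne'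
  have hi := hh.hasDerivAt_tiltInv hs hG hv hz
  have h1 := (hasDerivAt_gaussianPDFReal_standard (tiltInv h G v z)).comp z hi
  have h2 := (hh.hasDerivAt_tiltMoment hs hG hv 1 (tiltInv h G v z)).comp z hi
  refine (h1.div h2 hM).congr_deriv ?_
  simp only [tiltDensityDeriv, Function.comp_apply, Nat.reduceAdd]
  field_simp
  ring

lemma tiltDensity_nonneg (hh : IsTilt h s) (hG : Continuous G) (hv : 0 < v) (z : ℝ) :
    0 ≤ tiltDensity h G v z :=
  div_nonneg (gaussianPDFReal_nonneg _ _ _) (hh.tiltMoment_pos hG hv 1 _).le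

lemma inv_tiltMoment_one_le (hh : IsTilt h s) (hs : s ≤ 1) (hG : Continuous G) {θ : ℝ}
    (hθ : 0 < θ) (hθv : θ ≤ v) {J : ℝ} (hJ : J = ∫ u in (0 : ℝ)..θ, h u * Real.exp (G u))
    (hJpos : 0 < J) (x : ℝ) :
    (tiltMoment h G v 1 x)⁻¹ ≤ Real.exp |x| * J⁻¹ := by
  have h1 := hh.le_tiltMoment_one hs hG hθ hθv x
  rw [← hJ] at h1
  have h2 := inv_anti₀ (by positivity) h1
  rwa [mul_inv, Real.exp_neg, inv_inv] at h2

lemma tiltDensity_le (hh : IsTilt h s) (hs : s ≤ 1) (hG : Continuous G) {θ : ℝ}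
    (hθ : 0 < θ) (hθv : θ ≤ v) {J : ℝ} (hJ : J = ∫ u in (0 : ℝ)..θ, h u * Real.exp (G u))
    (hJpos : 0 < J) (z : ℝ) :
    tiltDensity h G v z ≤
      Real.exp 9 * Real.exp (-(tiltInv h G v z) ^ 2 / 4) * J⁻¹ := by
  set x := tiltInv h G v z with hx
  rw [tiltDensity, ← hx, div_eq_mul_inv]
  calc gaussianPDFReal 0 1 x * (tiltMoment h G v 1 x)⁻¹
      ≤ Real.exp (-x ^ 2 / 2) * (Real.exp |x| * J⁻¹) :=
        mul_le_mul (gaussianPDFReal_standard_le x)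
          (hh.inv_tiltMoment_one_le hs hG hθ hθv hJ hJpos x)
          (inv_nonneg.2 (hh.tiltMoment_pos hG (hθ.trans_le hθv) 1 x).le) (Real.exp_pos _).le
    _ = Real.exp (-x ^ 2 / 2 + |x|) * J⁻¹ := by rw [Real.exp_add, mul_assoc]
    -- Here a smaller constant than 9 would do. The derivative bound needs 3|x| ≤ 9 + x²/4, and
    -- sharing the constant lets both bounds enter `integral_le_of_le`.
    _ ≤ Real.exp (9 + -x ^ 2 / 4) * J⁻¹ := by
        refine mul_le_mul_of_nonneg_right (Real.exp_le_exp.2 ?_) (inv_pos.2 hJpos).le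
        rw [← sq_abs x]
        nlinarith [sq_nonneg (|x| - 2)]
    _ = _ := by rw [Real.exp_add]

lemma abs_tiltDensityDeriv_le (hh : IsTilt h s) (hs : s ≤ 1) (hG : Continuous G) {θ : ℝ}
    (hθ : 0 < θ) (hθv : θ ≤ v) {J : ℝ} (hJ : J = ∫ u in (0 : ℝ)..θ, h u * Real.exp (G u))
    (hJpos : 0 < J) (z : ℝ) :
    |tiltDensityDeriv h G v z| ≤
      Real.exp 9 * Real.exp (-(tiltInv h G v z) ^ 2 / 4) * (J⁻¹) ^ 2 := by
  have hv := hθ.trans_le hθv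
  set x := tiltInv h G v z with hx
  have hM1 := hh.tiltMoment_pos hG hv 1 x
  have hM2 := hh.tiltMoment_pos hG hv 2 x
  have hM := hh.tiltMoment_succ_le hs hG hv 1 x
  have hinv := hh.inv_tiltMoment_one_le hs hG hθ hθv hJ hJpos x
  rw [tiltDensityDeriv, ← hx, abs_mul, abs_neg, abs_of_nonneg (gaussianPDFReal_nonneg _ _ _)]
  have h1 : |x / tiltMoment h G v 1 x ^ 2 + tiltMoment h G v 2 x / tiltMoment h G v 1 x ^ 3| ≤
      (|x| + 1) * (tiltMoment h G v 1 x)⁻¹ ^ 2 := by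
    refine (abs_add_le _ _).trans ?_
    rw [abs_div, abs_of_pos (show 0 < tiltMoment h G v 1 x ^ 2 by positivity),
      abs_of_pos (show 0 < tiltMoment h G v 2 x / tiltMoment h G v 1 x ^ 3 by positivity),
      add_mul, one_mul]
    have h2 : tiltMoment h G v 2 x / tiltMoment h G v 1 x ^ 3 ≤
        tiltMoment h G v 1 x / tiltMoment h G v 1 x ^ 3 := by gcongr
    have h3 : tiltMoment h G v 1 x / tiltMoment h G v 1 x ^ 3 = (tiltMoment h G v 1 x)⁻¹ ^ 2 := by
      field_simp
    have h4 : |x| / tiltMoment h G v 1 x ^ 2 = |x| * (tiltMoment h G v 1 x)⁻¹ ^ 2 := by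
      field_simp
    linarith
  have h5 : (tiltMoment h G v 1 x)⁻¹ ^ 2 ≤ (Real.exp |x| * J⁻¹) ^ 2 := by gcongr
  calc gaussianPDFReal 0 1 x *
        |x / tiltMoment h G v 1 x ^ 2 + tiltMoment h G v 2 x / tiltMoment h G v 1 x ^ 3|
      ≤ Real.exp (-x ^ 2 / 2) * (Real.exp |x| * (Real.exp |x| * J⁻¹) ^ 2) := by
        refine mul_le_mul (gaussianPDFReal_standard_le x) (h1.trans ?_) (abs_nonneg _)
          (Real.exp_pos _).le
        exact mul_le_mul (Real.add_one_le_exp _) h5 (by positivity) (Real.exp_pos _).le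
    -- One |x| comes from |x| + 1 ≤ exp |x|, the other two from the square of 1/M_1.
    _ = Real.exp (-x ^ 2 / 2 + (|x| + (|x| + |x|))) * (J⁻¹) ^ 2 := by
        rw [Real.exp_add, Real.exp_add, Real.exp_add]; ring
    _ ≤ Real.exp (9 + -x ^ 2 / 4) * (J⁻¹) ^ 2 := by
        refine mul_le_mul_of_nonneg_right (Real.exp_le_exp.2 ?_) (by positivity)
        rw [← sq_abs x]
        nlinarith [sq_nonneg (|x| - 6)]
    _ = _ := by rw [Real.exp_add]

end IsTilt

/-! ### Measurability and the law of the tilted integral -/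

namespace IsTilt

variable {Ω : Type*} [MeasurableSpace Ω] {h : ℝ → ℝ} {s v : ℝ} {G : ℝ → Ω → ℝ}

lemma measurable_tiltMoment (hh : IsTilt h s) (hv : 0 < v)
    (hGc : ∀ ω, Continuous fun u => G u ω) (hGm : ∀ u, Measurable (G u)) (n : ℕ) :
    Measurable fun p : ℝ × Ω => tiltMoment h (fun u => G u p.2) v n p.1 := by
  have hG : Measurable (Function.uncurry G) := measurable_uncurry_of_continuous_of_measurable hGc hGm
  have hm := hh.continuous.measurable
  simp only [tiltMoment, intervalIntegral.integral_of_le hv.le]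
  refine StronglyMeasurable.measurable (StronglyMeasurable.integral_prod_right
    (f := fun (p : ℝ × Ω) u => h u ^ n * Real.exp (h u * p.1 + G u p.2)) ?_)
  refine Measurable.stronglyMeasurable ?_
  have h1 : Measurable fun q : (ℝ × Ω) × ℝ => G q.2 q.1.2 :=
    hG.comp (measurable_snd.prodMk (measurable_snd.comp measurable_fst))
  have h2 : Measurable fun q : (ℝ × Ω) × ℝ => h q.2 := hm.comp measurable_snd
  exact (h2.pow_const n).mul
    (((h2.mul (measurable_fst.comp measurable_fst)).add h1).exp)

lemma measurable_tiltInv (hh : IsTilt h s) (hs : s ≤ 1) (hv : 0 < v)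
    (hGc : ∀ ω, Continuous fun u => G u ω) (hGm : ∀ u, Measurable (G u)) :
    Measurable fun p : ℝ × Ω => tiltInv h (fun u => G u p.2) v p.1 := by
  refine measurable_of_Iic fun x => ?_
  -- By monotonicity, for z > 0 the inverse is at most x iff z ≤ M_0(x). For z ≤ 0 the default value
  -- 0 decides, which gives the second set.
  have h1 : MeasurableSet {p : ℝ × Ω | 0 < p.1 ∧ p.1 ≤ tiltMoment h (fun u => G u p.2) v 0 x} :=
    (measurableSet_lt measurable_const measurable_fst).inter
      (measurableSet_le measurable_fst
        ((hh.measurable_tiltMoment hv hGc hGm 0).comp (measurable_const.prodMk measurable_snd)))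
  have h2 : MeasurableSet {p : ℝ × Ω | p.1 ≤ 0 ∧ 0 ≤ x} :=
    (measurableSet_le measurable_fst measurable_const).inter (MeasurableSet.const _)
  convert h1.union h2 using 1
  ext p
  simp only [Set.mem_preimage, Set.mem_Iic, Set.mem_union, Set.mem_ofPred_eq]
  rcases lt_or_ge 0 p.1 with hp | hp
  · rw [← (hh.strictMono_tiltMoment hs (hGc p.2) hv 0).le_iff_le,
      hh.tiltMoment_tiltInv hs (hGc p.2) hv hp]
    simp [hp]
  · simp [tiltInv, hp, not_lt.2 hp]

lemma measurable_tiltDensity (hh : IsTilt h s) (hs : s ≤ 1) (hv : 0 < v)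
    (hGc : ∀ ω, Continuous fun u => G u ω) (hGm : ∀ u, Measurable (G u)) :
    Measurable fun p : ℝ × Ω => tiltDensity h (fun u => G u p.2) v p.1 := by
  have hi := hh.measurable_tiltInv hs hv hGc hGm
  exact ((measurable_gaussianPDFReal 0 1).comp hi).div
    ((hh.measurable_tiltMoment hv hGc hGm 1).comp (hi.prodMk measurable_snd))

lemma measurable_tiltDensityDeriv (hh : IsTilt h s) (hs : s ≤ 1) (hv : 0 < v)
    (hGc : ∀ ω, Continuous fun u => G u ω) (hGm : ∀ u, Measurable (G u)) :
    Measurable fun p : ℝ × Ω => tiltDensityDeriv h (fun u => G u p.2) v p.1 := by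
  have hi := hh.measurable_tiltInv hs hv hGc hGm
  have h1 := (hh.measurable_tiltMoment hv hGc hGm 1).comp (hi.prodMk measurable_snd)
  have h2 := (hh.measurable_tiltMoment hv hGc hGm 2).comp (hi.prodMk measurable_snd)
  exact (((measurable_gaussianPDFReal 0 1).comp hi).neg).mul
    ((hi.div (h1.pow_const 2)).add (h2.div (h1.pow_const 3)))

lemma measurable_tiltDensity_right (hh : IsTilt h s) (hs : s ≤ 1) (hv : 0 < v)
    (hGc : ∀ ω, Continuous fun u => G u ω) (hGm : ∀ u, Measurable (G u)) (z : ℝ) :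
    Measurable fun ω => tiltDensity h (fun u => G u ω) v z :=
  Measurable.of_uncurry_left (f := fun y ω => tiltDensity h (fun u => G u ω) v y)
    (hh.measurable_tiltDensity hs hv hGc hGm)

lemma measurable_tiltDensityDeriv_right (hh : IsTilt h s) (hs : s ≤ 1) (hv : 0 < v)
    (hGc : ∀ ω, Continuous fun u => G u ω) (hGm : ∀ u, Measurable (G u)) (z : ℝ) :
    Measurable fun ω => tiltDensityDeriv h (fun u => G u ω) v z :=
  Measurable.of_uncurry_left (f := fun y ω => tiltDensityDeriv h (fun u => G u ω) v y)
    (hh.measurable_tiltDensityDeriv hs hv hGc hGm)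

/-- Change of variables z = M_0(x) on the whole line: the Jacobian M_1(x) cancels the denominator of
the density. -/
lemma gaussianReal_preimage_tiltMoment {G : ℝ → ℝ} (hh : IsTilt h s) (hs : s ≤ 1)
    (hG : Continuous G) (hv : 0 < v) {B : Set ℝ} (hB : MeasurableSet B) :
    gaussianReal 0 1 (tiltMoment h G v 0 ⁻¹' B) =
      ∫⁻ z in Set.Ioi 0, B.indicator (fun z => ENNReal.ofReal (tiltDensity h G v z)) z := by
  have himage : tiltMoment h G v 0 '' Set.univ = Set.Ioi 0 := by
    ext z
    constructor
    · rintro ⟨x, -, rfl⟩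
      exact hh.tiltMoment_pos hG hv 0 x
    · intro hz
      obtain ⟨x, hx⟩ := hh.exists_tiltMoment_eq hs hG hv hz
      exact ⟨x, trivial, hx⟩
  rw [← himage, lintegral_image_eq_lintegral_abs_deriv_mul MeasurableSet.univ
    (fun x _ => (hh.hasDerivAt_tiltMoment hs hG hv 0 x).hasDerivWithinAt)
    (hh.strictMono_tiltMoment hs hG hv 0).injective.injOn, Measure.restrict_univ,
    gaussianReal_apply _ one_ne_zero,
    ← lintegral_indicator ((hh.continuous_tiltMoment hs hG hv 0).measurable hB)]
  refine lintegral_congr fun x => ?_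
  by_cases hx : tiltMoment h G v 0 x ∈ B
  · have hM := hh.tiltMoment_pos hG hv 1 x
    rw [Set.indicator_of_mem hx, Set.indicator_of_mem (Set.mem_preimage.2 hx),
      ← ENNReal.ofReal_mul (abs_nonneg _), tiltDensity, hh.tiltInv_tiltMoment hs hG hv,
      zero_add, abs_of_pos hM, mul_div_cancel₀ _ hM.ne', gaussianPDF]
  · rw [Set.indicator_of_notMem hx, Set.indicator_of_notMem (by simpa using hx), mul_zero]

theorem map_tiltMoment (hh : IsTilt h s) (hs : s ≤ 1) (hv : 0 < v)
    (hGc : ∀ ω, Continuous fun u => G u ω) (hGm : ∀ u, Measurable (G u))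
    (Q : Measure Ω) [IsProbabilityMeasure Q] :
    ((gaussianReal 0 1).prod Q).map
        (fun p : ℝ × Ω => tiltMoment h (fun u => G u p.2) v 0 p.1) =
      (volume.restrict (Set.Ioi 0)).withDensity fun z =>
        ∫⁻ ω, ENNReal.ofReal (tiltDensity h (fun u => G u ω) v z) ∂Q := by
  have hM := hh.measurable_tiltMoment hv hGc hGm 0
  have hd := (hh.measurable_tiltDensity hs hv hGc hGm).ennreal_ofReal
  ext B hB
  rw [Measure.map_apply hM hB, Measure.prod_apply_symm (hM hB), withDensity_apply _ hB,
    ← lintegral_indicator hB]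
  have h1 : ∀ ω, gaussianReal 0 1 ((fun x => (x, ω)) ⁻¹'
      ((fun p : ℝ × Ω => tiltMoment h (fun u => G u p.2) v 0 p.1) ⁻¹' B)) =
      ∫⁻ z in Set.Ioi 0, B.indicator
        (fun z => ENNReal.ofReal (tiltDensity h (fun u => G u ω) v z)) z := fun ω =>
    hh.gaussianReal_preimage_tiltMoment hs (hGc ω) hv hB
  simp_rw [h1]
  rw [lintegral_lintegral_swap]
  · refine lintegral_congr fun z => ?_
    by_cases hz : z ∈ B
    · simp [hz]
    · simp [hz]
  · have h2 : Measurable fun p : Ω × ℝ => (Prod.snd ⁻¹' B : Set (Ω × ℝ)).indicator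
        (fun p => ENNReal.ofReal (tiltDensity h (fun u => G u p.1) v p.2)) p :=
      (hd.comp measurable_swap).indicator (measurable_snd hB)
    exact h2.aemeasurable

end IsTilt

/-! ### Moment and tail estimates -/

/-- The convex power y ↦ y^a lies above its tangent at 1, evaluated at y = exp g. This is
Bernoulli's inequality for a ≥ 1; for a ≤ 0 it follows from 1 + t ≤ exp t used twice. -/
lemma one_add_mul_le_exp_mul {a : ℝ} (ha : 1 ≤ a ∨ a ≤ 0) (g : ℝ) :
    1 + a * (Real.exp g - 1) ≤ Real.exp (a * g) := by
  rcases ha with ha | ha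
  · have h1 := one_add_mul_self_le_rpow_one_add (s := Real.exp g - 1)
      (by linarith [Real.exp_pos g]) ha
    rwa [add_sub_cancel, ← Real.exp_mul, mul_comm g a] at h1
  · nlinarith [Real.add_one_le_exp (a * g), Real.add_one_le_exp g]

/-- Jensen's inequality for the powers `y ↦ y ^ a`, `a ≥ 1` or `a ≤ 0`, in exponential form. -/
lemma mul_exp_mul_log_le_integral {w G : ℝ → ℝ} {b W J a : ℝ} (hw : Continuous w)
    (hG : Continuous G) (hb : 0 ≤ b) (hw0 : ∀ u, 0 ≤ u → 0 ≤ w u)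
    (hW : ∫ u in (0 : ℝ)..b, w u = W) (hJ : ∫ u in (0 : ℝ)..b, w u * Real.exp (G u) = J)
    (hWpos : 0 < W) (hJpos : 0 < J) (ha : 1 ≤ a ∨ a ≤ 0) :
    W * Real.exp (a * Real.log (J / W)) ≤ ∫ u in (0 : ℝ)..b, w u * Real.exp (a * G u) := by
  set c := Real.log (J / W) with hc
  have hec : Real.exp c = J / W := Real.exp_log (by positivity)
  -- The integrand is the tangent bound taken at the weighted mean J/W of exp(G); its linear part
  -- integrates to zero.
  have h1 : ∫ u in (0 : ℝ)..b, Real.exp (a * c) *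
      ((1 - a) * w u + a * Real.exp (-c) * (w u * Real.exp (G u))) =
      W * Real.exp (a * c) := by
    rw [intervalIntegral.integral_const_mul, intervalIntegral.integral_add
      (Continuous.intervalIntegrable (by fun_prop) _ _)
      (Continuous.intervalIntegrable (by fun_prop) _ _), intervalIntegral.integral_const_mul,
      intervalIntegral.integral_const_mul, hW, hJ, Real.exp_neg, hec]
    field_simp
    ring
  rw [← h1]
  refine intervalIntegral.integral_mono_on hb (Continuous.intervalIntegrable (by fun_prop) _ _)
    (Continuous.intervalIntegrable (by fun_prop) _ _) fun u hu => ?_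
  have h2 := one_add_mul_le_exp_mul ha (G u - c)
  have h3 : Real.exp (a * G u) = Real.exp (a * c) * Real.exp (a * (G u - c)) := by
    rw [← Real.exp_add]
    ring_nf
  have h4 : Real.exp (G u - c) = Real.exp (-c) * Real.exp (G u) := by
    rw [← Real.exp_add]
    ring_nf
  rw [h4] at h2
  rw [h3]
  calc Real.exp (a * c) * ((1 - a) * w u + a * Real.exp (-c) * (w u * Real.exp (G u)))
      = w u * (Real.exp (a * c) * (1 + a * (Real.exp (-c) * Real.exp (G u) - 1))) := by ring
    _ ≤ w u * (Real.exp (a * c) * Real.exp (a * (G u - c))) := by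
        have := hw0 u hu.1
        gcongr

section Moments

variable {Ω : Type*} [MeasurableSpace Ω] {G : ℝ → Ω → ℝ}

lemma lintegral_integral_mul_exp_le {Q : Measure Ω} [SFinite Q] {w : ℝ → ℝ} {a b C : ℝ}
    (hGc : ∀ ω, Continuous fun u => G u ω) (hGm : ∀ u, Measurable (G u))
    (hw : Continuous w) (hw0 : ∀ u, 0 ≤ u → 0 ≤ w u) (hb : 0 ≤ b) (hC : 0 ≤ C)
    (hE : ∀ u, 0 ≤ u → u ≤ b →
      ∫⁻ ω, ENNReal.ofReal (Real.exp (a * G u ω)) ∂Q ≤ ENNReal.ofReal C) :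
    ∫⁻ ω, ENNReal.ofReal (∫ u in (0 : ℝ)..b, w u * Real.exp (a * G u ω)) ∂Q ≤
      ENNReal.ofReal ((∫ u in (0 : ℝ)..b, w u) * C) := by
  have hG : Measurable (Function.uncurry G) := measurable_uncurry_of_continuous_of_measurable hGc hGm
  have hwi : IntegrableOn w (Set.Ioc 0 b) := (hw.intervalIntegrable 0 b).1
  have hwnn : 0 ≤ᵐ[volume.restrict (Set.Ioc 0 b)] w := by
    filter_upwards [ae_restrict_mem measurableSet_Ioc] with u hu using hw0 u hu.1.le
  have h1 : ∀ ω, ENNReal.ofReal (∫ u in (0 : ℝ)..b, w u * Real.exp (a * G u ω)) =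
      ∫⁻ u in Set.Ioc 0 b, ENNReal.ofReal (w u) * ENNReal.ofReal (Real.exp (a * G u ω)) := by
    intro ω
    have hc : Continuous fun u => w u * Real.exp (a * G u ω) := by
      have := hGc ω
      fun_prop
    rw [intervalIntegral.integral_of_le hb, ofReal_integral_eq_lintegral_ofReal
      (hc.intervalIntegrable 0 b).1]
    · exact lintegral_congr fun u => ENNReal.ofReal_mul' (Real.exp_pos _).le
    · filter_upwards [ae_restrict_mem measurableSet_Ioc] with u hu
      exact mul_nonneg (hw0 u hu.1.le) (Real.exp_pos _).le
  simp_rw [h1]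
  rw [lintegral_lintegral_swap]
  · calc ∫⁻ u in Set.Ioc 0 b, ∫⁻ ω, ENNReal.ofReal (w u) *
          ENNReal.ofReal (Real.exp (a * G u ω)) ∂Q
        ≤ ∫⁻ u in Set.Ioc 0 b, ENNReal.ofReal (w u) * ENNReal.ofReal C := by
          refine setLIntegral_mono' measurableSet_Ioc fun u hu => ?_
          rw [lintegral_const_mul _ (((hGm u).const_mul a).exp.ennreal_ofReal)]
          gcongr
          exact hE u hu.1.le hu.2
      _ = ENNReal.ofReal ((∫ u in (0 : ℝ)..b, w u) * C) := by
          rw [lintegral_mul_const _ hw.measurable.ennreal_ofReal, ENNReal.ofReal_mul' hC,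
            intervalIntegral.integral_of_le hb, ofReal_integral_eq_lintegral_ofReal hwi hwnn]
  · have h2 : Measurable fun p : Ω × ℝ => G p.2 p.1 := hG.comp measurable_swap
    exact ((hw.measurable.comp measurable_snd).ennreal_ofReal.mul
      (h2.const_mul a).exp.ennreal_ofReal).aemeasurable

lemma integrable_and_integral_le {Q : Measure Ω} {X : Ω → ℝ} {C : ℝ} (hX : Measurable X)
    (hX0 : ∀ ω, 0 ≤ X ω) (hC : 0 ≤ C)
    (h : ∫⁻ ω, ENNReal.ofReal (X ω) ∂Q ≤ ENNReal.ofReal C) :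
    Integrable X Q ∧ ∫ ω, X ω ∂Q ≤ C := by
  have h0 : 0 ≤ᵐ[Q] X := Filter.Eventually.of_forall hX0
  refine ⟨⟨hX.aestronglyMeasurable, ?_⟩, ?_⟩
  · rw [hasFiniteIntegral_iff_ofReal h0]
    exact h.trans_lt ENNReal.ofReal_lt_top
  · rw [integral_eq_lintegral_of_nonneg_ae h0 hX.aestronglyMeasurable]
    exact ENNReal.toReal_le_of_le_ofReal hC h

/-- The exponential moments of `G u` are at most those of `N(-T u / 2, T u)`. -/
structure HasExpMoments (G : ℝ → Ω → ℝ) (T v : ℝ) (Q : Measure Ω) : Prop where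
  continuous : ∀ ω, Continuous fun u => G u ω
  measurable : ∀ u, Measurable (G u)
  lintegral_le : ∀ u, 0 ≤ u → u ≤ v → ∀ a : ℝ,
    ∫⁻ ω, ENNReal.ofReal (Real.exp (a * G u ω)) ∂Q ≤
      ENNReal.ofReal (Real.exp ((a ^ 2 - a) * (T * u) / 2))

variable {h : ℝ → ℝ} {s v T θ : ℝ} {Q : Measure Ω} [IsProbabilityMeasure Q]

/-- Jensen's inequality with exponent -k for the probability weight h/H on [0, θ] reduces the claim
to E exp(-k G_u). The condition Tθ ≤ 1 makes these moments bounded by a constant depending only on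
k. -/
lemma HasExpMoments.inv_tiltMoment_pow (hG : HasExpMoments G T v Q) (hh : IsTilt h s)
    (hT : 0 < T) (hθ : 0 < θ) (hθv : θ ≤ v) (hTθ : T * θ ≤ 1) (k : ℕ) :
    Integrable (fun ω => (tiltMoment h (fun u => G u ω) θ 1 0)⁻¹ ^ k) Q ∧
      ∫ ω, (tiltMoment h (fun u => G u ω) θ 1 0)⁻¹ ^ k ∂Q ≤
        (∫ u in (0 : ℝ)..θ, h u)⁻¹ ^ k * Real.exp (((k : ℝ) ^ 2 + k) / 2) := by
  have hc := hh.continuous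
  set H := ∫ u in (0 : ℝ)..θ, h u with hH
  have hHpos : 0 < H := intervalIntegral.intervalIntegral_pos_of_pos_on
    (hc.intervalIntegrable _ _) (fun u hu => hh.pos u hu.1) hθ
  have hJpos : ∀ ω, 0 < tiltMoment h (fun u => G u ω) θ 1 0 := fun ω =>
    hh.tiltMoment_pos (hG.continuous ω) hθ 1 0
  have hJm : Measurable fun ω => tiltMoment h (fun u => G u ω) θ 1 0 :=
    (hh.measurable_tiltMoment hθ hG.continuous hG.measurable 1).comp
      (measurable_const.prodMk measurable_id)
  refine integrable_and_integral_le (hJm.inv.pow_const k)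
    (fun ω => pow_nonneg (inv_nonneg.2 (hJpos ω).le) k) (by positivity) ?_
  have h1 : ∀ ω, (tiltMoment h (fun u => G u ω) θ 1 0)⁻¹ ^ k ≤
      H⁻¹ ^ (k + 1) * ∫ u in (0 : ℝ)..θ, h u * Real.exp (-(k : ℝ) * G u ω) := by
    intro ω
    set J := tiltMoment h (fun u => G u ω) θ 1 0 with hJ
    have h2 := mul_exp_mul_log_le_integral (a := -(k : ℝ)) (J := J) hc (hG.continuous ω) hθ.le
      hh.nonneg hH.symm (by simp [hJ, tiltMoment]) hHpos (hJpos ω) (Or.inr (by simp))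
    have h3 : Real.exp (-(k : ℝ) * Real.log (J / H)) = (H / J) ^ k := by
      rw [neg_mul, ← mul_neg, ← Real.log_inv, inv_div, mul_comm, ← Real.rpow_def_of_pos
        (div_pos hHpos (hJpos ω)), Real.rpow_natCast]
    rw [h3] at h2
    calc J⁻¹ ^ k = H⁻¹ ^ (k + 1) * (H * (H / J) ^ k) := by
          have h4 : J ≠ 0 := (hJpos ω).ne'
          rw [div_pow, pow_succ, inv_pow, inv_pow]
          field_simp
      _ ≤ _ := by gcongr
  calc ∫⁻ ω, ENNReal.ofReal ((tiltMoment h (fun u => G u ω) θ 1 0)⁻¹ ^ k) ∂Q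
      ≤ ∫⁻ ω, ENNReal.ofReal (H⁻¹ ^ (k + 1)) *
          ENNReal.ofReal (∫ u in (0 : ℝ)..θ, h u * Real.exp (-(k : ℝ) * G u ω)) ∂Q := by
        refine lintegral_mono fun ω => ?_
        rw [← ENNReal.ofReal_mul (by positivity)]
        exact ENNReal.ofReal_le_ofReal (h1 ω)
    _ = ENNReal.ofReal (H⁻¹ ^ (k + 1)) *
          ∫⁻ ω, ENNReal.ofReal (∫ u in (0 : ℝ)..θ, h u * Real.exp (-(k : ℝ) * G u ω)) ∂Q :=
        lintegral_const_mul' _ _ ENNReal.ofReal_ne_top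
    _ ≤ ENNReal.ofReal (H⁻¹ ^ (k + 1)) *
          ENNReal.ofReal (H * Real.exp (((k : ℝ) ^ 2 + k) / 2)) := by
        gcongr
        refine lintegral_integral_mul_exp_le hG.continuous hG.measurable hc hh.nonneg hθ.le
          (Real.exp_pos _).le fun u hu0 hu => ?_
        refine (hG.lintegral_le u hu0 (hu.trans hθv) _).trans (ENNReal.ofReal_le_ofReal ?_)
        refine Real.exp_le_exp.2 ?_
        have h4 : T * u ≤ 1 := (mul_le_mul_of_nonneg_left hu hT.le).trans hTθ
        have h5 : (0 : ℝ) ≤ (k : ℝ) ^ 2 + k := by positivity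
        nlinarith [mul_le_mul_of_nonneg_left h4 h5]
    _ = _ := by
        rw [← ENNReal.ofReal_mul (by positivity)]
        congr 1
        rw [pow_succ]
        field_simp

/-- Chernoff's bound: Jensen's inequality turns the event into one about ∫ exp(k G), to which
Markov's inequality applies. -/
lemma HasExpMoments.measureReal_le (hG : HasExpMoments G T v Q) (hT : 0 < T) (hv : 0 < v)
    {r : ℝ} (hr : 0 ≤ r) :
    Q.real {ω | v * Real.exp r ≤ ∫ u in (0 : ℝ)..v, Real.exp (G u ω)} ≤
      Real.exp (-(r ^ 2 / (2 * (T * v)))) := by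
  set E := {ω | v * Real.exp r ≤ ∫ u in (0 : ℝ)..v, Real.exp (G u ω)} with hE
  have hTv : 0 < T * v := mul_pos hT hv
  -- A near-minimiser of (k² - k)Tv/2 - kr, truncated at 1 because Jensen's inequality needs k ≥ 1.
  set k := max 1 (r / (T * v)) with hk
  have hk1 : 1 ≤ k := le_max_left _ _
  have hexp : (k ^ 2 - k) * (T * v) / 2 - k * r ≤ -(r ^ 2 / (2 * (T * v))) := by
    obtain ⟨y, hy⟩ : ∃ y, y = r / (T * v) := ⟨_, rfl⟩
    have hry : r = y * (T * v) := by rw [hy]; field_simp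
    have h1 : r ^ 2 / (2 * (T * v)) = y ^ 2 * (T * v) / 2 := by rw [hry]; field_simp
    have hy0 : 0 ≤ y := by rw [hy]; positivity
    rw [h1]
    rw [← hy] at hk
    rcases le_total y 1 with h2 | h2
    · rw [max_eq_left h2] at hk
      rw [hk, hry]
      have := mul_le_mul_of_nonneg_right h2 hy0
      nlinarith
    · rw [max_eq_right h2] at hk
      rw [hk, hry]
      nlinarith
  have hmark := mul_meas_ge_le_lintegral₀ (μ := Q)
    (f := fun ω => ENNReal.ofReal (∫ u in (0 : ℝ)..v, 1 * Real.exp (k * G u ω)))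
    (by
      have hGm : Measurable (Function.uncurry G) :=
        measurable_uncurry_of_continuous_of_measurable hG.continuous hG.measurable
      simp only [intervalIntegral.integral_of_le hv.le]
      refine (StronglyMeasurable.measurable (StronglyMeasurable.integral_prod_right
        (f := fun ω u => 1 * Real.exp (k * G u ω)) ?_)).ennreal_ofReal.aemeasurable
      have h2 : Measurable fun p : Ω × ℝ => G p.2 p.1 := hGm.comp measurable_swap
      exact ((h2.const_mul k).exp.const_mul 1).stronglyMeasurable)
    (ENNReal.ofReal (v * Real.exp (k * r)))
  have hsub : E ⊆ {ω | ENNReal.ofReal (v * Real.exp (k * r)) ≤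
      ENNReal.ofReal (∫ u in (0 : ℝ)..v, 1 * Real.exp (k * G u ω))} := by
    intro ω hω
    refine ENNReal.ofReal_le_ofReal ?_
    have hω' : v * Real.exp r ≤ ∫ u in (0 : ℝ)..v, Real.exp (G u ω) := hω
    set D := ∫ u in (0 : ℝ)..v, Real.exp (G u ω) with hD
    have hDpos : 0 < D := lt_of_lt_of_le (by positivity) hω'
    have h3 := mul_exp_mul_log_le_integral (w := fun _ => 1) (a := k) (W := v) (J := D)
      continuous_const (hG.continuous ω) hv.le (fun _ _ => zero_le_one) (by simp) (by simp [hD])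
      hv hDpos (Or.inl hk1)
    refine le_trans ?_ h3
    have h4 : r ≤ Real.log (D / v) := by
      rw [Real.le_log_iff_exp_le (by positivity), le_div_iff₀ hv]
      linarith
    gcongr
  have hfub := lintegral_integral_mul_exp_le (Q := Q) (w := fun _ => 1) (a := k) (b := v)
    (C := Real.exp ((k ^ 2 - k) * (T * v) / 2)) hG.continuous hG.measurable continuous_const
    (fun _ _ => zero_le_one) hv.le (Real.exp_pos _).le (fun u hu0 hu => by
      refine (hG.lintegral_le u hu0 hu k).trans (ENNReal.ofReal_le_ofReal ?_)
      have : 0 ≤ k ^ 2 - k := by nlinarith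
      gcongr)
  have hfin : ENNReal.ofReal (v * Real.exp (k * r)) * Q E ≤
      ENNReal.ofReal (v * Real.exp ((k ^ 2 - k) * (T * v) / 2)) := by
    refine (mul_le_mul_right (measure_mono hsub) _).trans (hmark.trans (hfub.trans ?_))
    simp
  have hreal := ENNReal.toReal_mono ENNReal.ofReal_ne_top hfin
  rw [ENNReal.toReal_mul, ENNReal.toReal_ofReal (by positivity),
    ENNReal.toReal_ofReal (by positivity), mul_assoc, mul_le_mul_iff_right₀ hv] at hreal
  have h5 : Q.real E ≤ Real.exp ((k ^ 2 - k) * (T * v) / 2 - k * r) := by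
    rw [Real.exp_sub, le_div_iff₀ (Real.exp_pos _), mul_comm]
    exact hreal
  exact h5.trans (Real.exp_le_exp.2 hexp)

end Moments

/-! ### The averaged density -/

section AveragedDensity

variable {Ω : Type*} [MeasurableSpace Ω] {G : ℝ → Ω → ℝ} {h : ℝ → ℝ} {s v T θ : ℝ}
  {Q : Measure Ω} [IsProbabilityMeasure Q]

/-- For `z > v`, either the Gaussian factor at `tiltInv` is small or the untilted integral is
large. -/
lemma IsTilt.exp_neg_sq_tiltInv_le {G : ℝ → ℝ} (hh : IsTilt h s) (hs : s ≤ 1)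
    (hsT : s ^ 2 ≤ T * v) (hT : 0 < T) (hG : Continuous G) (hv : 0 < v) {z : ℝ} (hz : v < z)
    (hD : ∫ u in (0 : ℝ)..v, Real.exp (G u) < v * Real.exp (Real.log (z / v) / 2)) :
    Real.exp (-(tiltInv h G v z) ^ 2 / 4) ≤
      Real.exp (-(Real.log (z / v) ^ 2 / (16 * (T * v)))) := by
  set x := tiltInv h G v z with hx
  set l := Real.log (z / v) with hl
  have hz0 : 0 < z := hv.trans hz
  have hlpos : 0 < l := Real.log_pos ((one_lt_div hv).2 hz)
  have h1 := hh.tiltMoment_zero_le hG hv x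
  rw [hx, hh.tiltMoment_tiltInv hs hG hv hz0, ← hx] at h1
  have h2 : z = v * Real.exp l := by
    rw [hl, Real.exp_log (by positivity)]
    field_simp
  have h3 : v * Real.exp l < v * Real.exp (s * |x| + l / 2) := by
    rw [← h2, Real.exp_add]
    calc z ≤ _ := h1
      _ < Real.exp (s * |x|) * (v * Real.exp (l / 2)) :=
        mul_lt_mul_of_pos_left hD (Real.exp_pos _)
      _ = _ := by ring
  have h4 : l < s * |x| + l / 2 := Real.exp_lt_exp.1 (lt_of_mul_lt_mul_left h3 hv.le)
  have h5 : (l / 2) ^ 2 ≤ (s * |x|) ^ 2 := by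
    have : l / 2 ≤ s * |x| := by linarith
    gcongr
  rw [mul_pow, sq_abs] at h5
  have h6 : (l / 2) ^ 2 ≤ (T * v) * x ^ 2 :=
    h5.trans (mul_le_mul_of_nonneg_right hsT (sq_nonneg x))
  refine Real.exp_le_exp.2 ?_
  rw [neg_div, neg_le_neg_iff, div_le_iff₀ (by positivity)]
  nlinarith

/-- A function of the size of `tiltDensity` (`k = 1`) or of its derivative (`k = 2`) has a small
integral. -/
lemma HasExpMoments.integral_le_of_le (hG : HasExpMoments G T v Q) (hh : IsTilt h s)
    (hs : s ≤ 1) (hsT : s ^ 2 ≤ T * v) (hT : 0 < T) (hθ : 0 < θ) (hθv : θ ≤ v)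
    (hTθ : T * θ ≤ 1) {k : ℕ} (hk : k = 1 ∨ k = 2) {z L : ℝ}
    (hL1 : z ≤ v → L = 1)
    (hL2 : v < z → L = Real.exp (-(Real.log (z / v) ^ 2 / (16 * (T * v)))))
    {F : Ω → ℝ} (hFm : Measurable F)
    (hF : ∀ ω, |F ω| ≤ Real.exp 9 * Real.exp (-(tiltInv h (fun u => G u ω) v z) ^ 2 / 4) *
      (tiltMoment h (fun u => G u ω) θ 1 0)⁻¹ ^ k) :
    Integrable F Q ∧
      ∫ ω, |F ω| ∂Q ≤ Real.exp 20 * (∫ u in (0 : ℝ)..θ, h u)⁻¹ ^ k * L := by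
  have hv := hθ.trans_le hθv
  set H := ∫ u in (0 : ℝ)..θ, h u with hH
  have hHpos : 0 < H := intervalIntegral.intervalIntegral_pos_of_pos_on
    (hh.continuous.intervalIntegrable _ _) (fun u hu => hh.pos u hu.1) hθ
  set Y : Ω → ℝ := fun ω => (tiltMoment h (fun u => G u ω) θ 1 0)⁻¹ with hY
  have hYpos : ∀ ω, 0 < Y ω := fun ω =>
    inv_pos.2 (hh.tiltMoment_pos (hG.continuous ω) hθ 1 0)
  obtain ⟨hi1, hb1⟩ := hG.inv_tiltMoment_pow hh hT hθ hθv hTθ k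
  obtain ⟨hi2, hb2⟩ := hG.inv_tiltMoment_pow hh hT hθ hθv hTθ (2 * k)
  rw [← hH] at hb1 hb2
  change Integrable (fun ω => Y ω ^ k) Q at hi1
  change Integrable (fun ω => Y ω ^ (2 * k)) Q at hi2
  change ∫ ω, Y ω ^ k ∂Q ≤ _ at hb1
  change ∫ ω, Y ω ^ (2 * k) ∂Q ≤ _ at hb2
  -- The moments used have order at most 4, and (4² + 4)/2 = 10.
  have he1 : Real.exp (((k : ℝ) ^ 2 + k) / 2) ≤ Real.exp 10 := by
    refine Real.exp_le_exp.2 ?_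
    rcases hk with rfl | rfl <;> norm_num
  have he2 : Real.exp ((((2 * k : ℕ) : ℝ) ^ 2 + (2 * k : ℕ)) / 2) ≤ Real.exp 10 := by
    refine Real.exp_le_exp.2 ?_
    rcases hk with rfl | rfl <;> norm_num
  have h10 : 1 ≤ Real.exp 10 := Real.one_le_exp (by norm_num)
  -- Leaves room for the final sum exp 10 + exp 10 / 2 + 1/2.
  have h11 : 2 * Real.exp 10 ≤ Real.exp 11 := by
    have : Real.exp 11 = Real.exp 10 * Real.exp 1 := by rw [← Real.exp_add]; norm_num
    nlinarith [Real.add_one_le_exp (1 : ℝ)]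
  have h20 : Real.exp 20 = Real.exp 9 * Real.exp 11 := by rw [← Real.exp_add]; norm_num
  have hFint : Integrable F Q := by
    refine (hi1.const_mul (Real.exp 9)).mono' hFm.aestronglyMeasurable
      (Filter.Eventually.of_forall fun ω => ?_)
    rw [Real.norm_eq_abs]
    refine (hF ω).trans (mul_le_mul_of_nonneg_right ?_ (pow_pos (hYpos ω) k).le)
    refine mul_le_of_le_one_right (Real.exp_pos _).le (Real.exp_le_one_iff.2 ?_)
    nlinarith [sq_nonneg (tiltInv h (fun u => G u ω) v z)]
  refine ⟨hFint, ?_⟩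
  rcases le_or_gt z v with hz | hz
  · rw [hL1 hz, mul_one]
    calc ∫ ω, |F ω| ∂Q ≤ ∫ ω, Real.exp 9 * Y ω ^ k ∂Q := by
          refine integral_mono hFint.abs (hi1.const_mul _) fun ω => ?_
          refine (hF ω).trans (mul_le_mul_of_nonneg_right ?_ (pow_pos (hYpos ω) k).le)
          refine mul_le_of_le_one_right (Real.exp_pos _).le (Real.exp_le_one_iff.2 ?_)
          nlinarith [sq_nonneg (tiltInv h (fun u => G u ω) v z)]
      _ = Real.exp 9 * ∫ ω, Y ω ^ k ∂Q := integral_const_mul _ _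
      _ ≤ Real.exp 9 * (H⁻¹ ^ k * Real.exp 11) := by
          refine mul_le_mul_of_nonneg_left (hb1.trans ?_) (Real.exp_pos _).le
          exact mul_le_mul_of_nonneg_left (by linarith) (by positivity)
      _ = _ := by rw [h20]; ring
  · rw [hL2 hz]
    set ε := Real.exp (-(Real.log (z / v) ^ 2 / (16 * (T * v)))) with hε
    have hεpos : 0 < ε := Real.exp_pos _
    set E := {ω | v * Real.exp (Real.log (z / v) / 2) ≤ ∫ u in (0 : ℝ)..v, Real.exp (G u ω)}
      with hE
    have hEm : MeasurableSet E := by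
      refine measurableSet_le measurable_const ?_
      have := (hh.measurable_tiltMoment hv hG.continuous hG.measurable 0).comp
        ((measurable_const (a := (0 : ℝ))).prodMk (measurable_id (α := Ω)))
      simpa [tiltMoment, Function.comp_def] using this
    -- The tail bound at r = l/2 has exponent l²/(8Tv), twice the exponent in ε.
    have hQE : Q.real E ≤ ε ^ 2 := by
      refine (hG.measureReal_le hT hv
        (div_nonneg (Real.log_pos ((one_lt_div hv).2 hz)).le zero_le_two)).trans ?_
      rw [hε, ← Real.exp_nat_mul]
      refine (Real.exp_le_exp.2 (le_of_eq ?_))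
      push_cast
      field_simp
      norm_num
    have hpt : ∀ ω, |F ω| ≤ Real.exp 9 * (ε * Y ω ^ k + (ε * H ^ k / 2) * Y ω ^ (2 * k) +
        E.indicator (fun _ => (H⁻¹ ^ k * ε⁻¹ / 2)) ω) := by
      intro ω
      refine (hF ω).trans ?_
      rw [mul_assoc]
      refine mul_le_mul_of_nonneg_left ?_ (Real.exp_pos _).le
      change Real.exp (-(tiltInv h (fun u => G u ω) v z) ^ 2 / 4) * Y ω ^ k ≤ _
      have hYk := pow_pos (hYpos ω) k
      by_cases hω : ω ∈ E
      · rw [Set.indicator_of_mem hω]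
        have h1 : Real.exp (-(tiltInv h (fun u => G u ω) v z) ^ 2 / 4) ≤ 1 :=
          Real.exp_le_one_iff.2 (by nlinarith [sq_nonneg (tiltInv h (fun u => G u ω) v z)])
        -- AM-GM, weighted so that both terms average to order ε H^(-k): the first because E Y^(2k)
        -- is of order H^(-2k), the second because E has probability at most ε².
        have h2 : Y ω ^ k ≤ (ε * H ^ k / 2) * Y ω ^ (2 * k) + H⁻¹ ^ k * ε⁻¹ / 2 := by
          have hHk := pow_pos hHpos k
          rw [inv_pow H, mul_comm 2 k, pow_mul, ← sub_nonneg]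
          have : (ε * H ^ k / 2) * (Y ω ^ k) ^ 2 + (H ^ k)⁻¹ * ε⁻¹ / 2 - Y ω ^ k =
              (ε * H ^ k * Y ω ^ k - 1) ^ 2 / (2 * (ε * H ^ k)) := by
            field_simp
            ring
          rw [this]
          positivity
        have h3 : 0 < ε * Y ω ^ k := by positivity
        nlinarith [mul_le_mul_of_nonneg_right h1 hYk.le]
      · rw [Set.indicator_of_notMem hω, add_zero]
        have h1 := hh.exp_neg_sq_tiltInv_le hs hsT hT (hG.continuous ω) hv hz
          (not_le.1 hω)
        have h2 : 0 ≤ (ε * H ^ k / 2) * Y ω ^ (2 * k) := by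
          have := hYpos ω
          positivity
        nlinarith [mul_le_mul_of_nonneg_right h1 hYk.le]
    have hiE : Integrable (E.indicator (fun _ => (H⁻¹ ^ k * ε⁻¹ / 2))) Q :=
      (integrable_const _).indicator hEm
    have hsum : ∫ ω, Real.exp 9 * (ε * Y ω ^ k + (ε * H ^ k / 2) * Y ω ^ (2 * k) +
        E.indicator (fun _ => (H⁻¹ ^ k * ε⁻¹ / 2)) ω) ∂Q =
        Real.exp 9 * (ε * (∫ ω, Y ω ^ k ∂Q) + (ε * H ^ k / 2) * (∫ ω, Y ω ^ (2 * k) ∂Q) +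
          Q.real E * (H⁻¹ ^ k * ε⁻¹ / 2)) := by
      have hi12 : Integrable (fun ω => ε * Y ω ^ k + (ε * H ^ k / 2) * Y ω ^ (2 * k)) Q :=
        (hi1.const_mul _).add (hi2.const_mul _)
      rw [integral_const_mul, integral_add hi12 hiE, integral_add (hi1.const_mul _) (hi2.const_mul _), integral_const_mul,
        integral_const_mul, integral_indicator_const _ hEm, smul_eq_mul]
    have hHk : H ^ k * H⁻¹ ^ (2 * k) = H⁻¹ ^ k := by
      rw [two_mul, pow_add, ← mul_assoc, ← mul_pow, mul_inv_cancel₀ hHpos.ne', one_pow, one_mul]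
    calc ∫ ω, |F ω| ∂Q ≤ _ := integral_mono hFint.abs
          ((((hi1.const_mul _).add (hi2.const_mul _)).add hiE).const_mul _) hpt
      _ = _ := hsum
      _ ≤ Real.exp 9 * (ε * (H⁻¹ ^ k * Real.exp 10) +
          (ε * H ^ k / 2) * (H⁻¹ ^ (2 * k) * Real.exp 10) + ε ^ 2 * (H⁻¹ ^ k * ε⁻¹ / 2)) := by
          have hb1' := hb1.trans (mul_le_mul_of_nonneg_left he1 (by positivity))
          have hb2' := hb2.trans (mul_le_mul_of_nonneg_left he2 (by positivity))
          gcongr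
      _ = Real.exp 9 * (H⁻¹ ^ k * ε * (Real.exp 10 + Real.exp 10 / 2 + 1 / 2)) := by
          have : (ε * H ^ k / 2) * (H⁻¹ ^ (2 * k) * Real.exp 10) =
              (H ^ k * H⁻¹ ^ (2 * k)) * ε * Real.exp 10 / 2 := by ring
          rw [this, hHk]
          field_simp
      _ ≤ Real.exp 9 * (H⁻¹ ^ k * ε * Real.exp 11) := by
          gcongr
          linarith
      _ = _ := by rw [h20]; ring

/-- The density of `∫₀ᵛ exp (X h + G)` for `X` standard normal and independent of `G`. -/
noncomputable def averagedTiltDensity (h : ℝ → ℝ) (G : ℝ → Ω → ℝ) (v : ℝ) (Q : Measure Ω)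
    (z : ℝ) : ℝ :=
  ∫ ω, tiltDensity h (fun u => G u ω) v z ∂Q

theorem HasExpMoments.averagedTiltDensity_bounds (hG : HasExpMoments G T v Q) (hh : IsTilt h s)
    (hs : s ≤ 1) (hsT : s ^ 2 ≤ T * v) (hT : 0 < T) (hθ : 0 < θ) (hθv : θ ≤ v)
    (hTθ : T * θ ≤ 1) {z L : ℝ} (hz : 0 < z) (hL1 : z ≤ v → L = 1)
    (hL2 : v < z → L = Real.exp (-(Real.log (z / v) ^ 2 / (16 * (T * v))))) :
    Integrable (fun ω => tiltDensity h (fun u => G u ω) v z) Q ∧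
      DifferentiableAt ℝ (averagedTiltDensity h G v Q) z ∧
      averagedTiltDensity h G v Q z ≤ Real.exp 20 * (∫ u in (0 : ℝ)..θ, h u)⁻¹ * L ∧
      |deriv (averagedTiltDensity h G v Q) z| ≤
        Real.exp 20 * (∫ u in (0 : ℝ)..θ, h u)⁻¹ ^ 2 * L := by
  have hv := hθ.trans_le hθv
  have hJ : ∀ ω, tiltMoment h (fun u => G u ω) θ 1 0 =
      ∫ u in (0 : ℝ)..θ, h u * Real.exp (G u ω) := fun ω => by simp [tiltMoment]
  have hJpos : ∀ ω, 0 < tiltMoment h (fun u => G u ω) θ 1 0 := fun ω =>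
    hh.tiltMoment_pos (hG.continuous ω) hθ 1 0
  have hpm := hh.measurable_tiltDensity_right hs hv hG.continuous hG.measurable
  have hdm := hh.measurable_tiltDensityDeriv_right hs hv hG.continuous hG.measurable z
  have hd : ∀ y ω, |tiltDensityDeriv h (fun u => G u ω) v y| ≤
      Real.exp 9 * Real.exp (-(tiltInv h (fun u => G u ω) v y) ^ 2 / 4) *
        (tiltMoment h (fun u => G u ω) θ 1 0)⁻¹ ^ 2 := fun y ω =>
    hh.abs_tiltDensityDeriv_le hs (hG.continuous ω) hθ hθv (hJ ω) (hJpos ω) y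
  obtain ⟨hi1, hb1⟩ := hG.integral_le_of_le hh hs hsT hT hθ hθv hTθ (k := 1) (Or.inl rfl) hL1 hL2
    (F := fun ω => tiltDensity h (fun u => G u ω) v z) (hpm z) fun ω => by
      rw [abs_of_nonneg (hh.tiltDensity_nonneg (hG.continuous ω) hv z), pow_one]
      exact hh.tiltDensity_le hs (hG.continuous ω) hθ hθv (hJ ω) (hJpos ω) z
  obtain ⟨hi2, hb2⟩ := hG.integral_le_of_le hh hs hsT hT hθ hθv hTθ (k := 2) (Or.inr rfl) hL1 hL2
    (F := fun ω => tiltDensityDeriv h (fun u => G u ω) v z) hdm (hd z)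
  have hderiv : HasDerivAt (averagedTiltDensity h G v Q)
      (∫ ω, tiltDensityDeriv h (fun u => G u ω) v z ∂Q) z := by
    -- The dominating function does not depend on y, so all of (0, ∞) serves as the neighbourhood of
    -- z.
    refine (hasDerivAt_integral_of_dominated_loc_of_deriv_le
      (F := fun y ω => tiltDensity h (fun u => G u ω) v y)
      (F' := fun y ω => tiltDensityDeriv h (fun u => G u ω) v y)
      (bound := fun ω => Real.exp 9 * (tiltMoment h (fun u => G u ω) θ 1 0)⁻¹ ^ 2)
      (Ioi_mem_nhds hz) (Filter.Eventually.of_forall fun y => (hpm y).aestronglyMeasurable)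
      hi1 hdm.aestronglyMeasurable (Filter.Eventually.of_forall fun ω y _ => ?_)
      ((hG.inv_tiltMoment_pow hh hT hθ hθv hTθ 2).1.const_mul _)
      (Filter.Eventually.of_forall fun ω y hy =>
        hh.hasDerivAt_tiltDensity hs (hG.continuous ω) hv hy)).2
    rw [Real.norm_eq_abs]
    refine (hd y ω).trans (mul_le_mul_of_nonneg_right ?_ (sq_nonneg _))
    refine mul_le_of_le_one_right (Real.exp_pos _).le (Real.exp_le_one_iff.2 ?_)
    nlinarith [sq_nonneg (tiltInv h (fun u => G u ω) v y)]
  refine ⟨hi1, hderiv.differentiableAt, ?_, ?_⟩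
  · rw [pow_one] at hb1
    exact (integral_mono hi1 hi1.abs fun ω => le_abs_self _).trans hb1
  · rw [hderiv.deriv]
    exact abs_integral_le_integral_abs.trans hb2

theorem HasExpMoments.map_tiltMoment_eq (hG : HasExpMoments G T v Q) (hh : IsTilt h s)
    (hs : s ≤ 1) (hsT : s ^ 2 ≤ T * v) (hT : 0 < T) (hθ : 0 < θ) (hθv : θ ≤ v)
    (hTθ : T * θ ≤ 1) :
    ((gaussianReal 0 1).prod Q).map
        (fun p : ℝ × Ω => tiltMoment h (fun u => G u p.2) v 0 p.1) =
      (volume.restrict (Set.Ioi 0)).withDensity fun z =>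
        ENNReal.ofReal (averagedTiltDensity h G v Q z) := by
  have hv := hθ.trans_le hθv
  rw [hh.map_tiltMoment hs hv hG.continuous hG.measurable]
  refine withDensity_congr_ae ?_
  filter_upwards [ae_restrict_mem measurableSet_Ioi] with z hz
  -- Only integrability in ω is used here; it turns the lower integral of the conditional densities
  -- into a Bochner integral.
  have hi := (hG.averagedTiltDensity_bounds hh hs hsT hT hθ hθv hTθ hz
    (L := if z ≤ v then 1 else Real.exp (-(Real.log (z / v) ^ 2 / (16 * (T * v)))))
    (fun h => if_pos h) (fun h => if_neg (not_le.2 h))).1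
  rw [averagedTiltDensity, ofReal_integral_eq_lintegral_ofReal hi
    (Filter.Eventually.of_forall fun ω => hh.tiltDensity_nonneg (hG.continuous ω) hv z)]

lemma IsTilt.measurable_averagedTiltDensity (hh : IsTilt h s) (hs : s ≤ 1) (hv : 0 < v)
    (hGc : ∀ ω, Continuous fun u => G u ω) (hGm : ∀ u, Measurable (G u)) :
    Measurable (averagedTiltDensity h G v Q) :=
  (StronglyMeasurable.integral_prod_right (f := fun z ω => tiltDensity h (fun u => G u ω) v z)
    (hh.measurable_tiltDensity hs hv hGc hGm).stronglyMeasurable).measurable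

end AveragedDensity

lemma IsTilt.averagedTiltDensity_nonneg {Ω : Type*} [MeasurableSpace Ω] {G : ℝ → Ω → ℝ}
    {h : ℝ → ℝ} {s v : ℝ} {Q : Measure Ω} (hh : IsTilt h s) (hv : 0 < v)
    (hGc : ∀ ω, Continuous fun u => G u ω) (z : ℝ) : 0 ≤ averagedTiltDensity h G v Q z :=
  integral_nonneg fun ω => hh.tiltDensity_nonneg (hGc ω) hv z

/-! ### Brownian motion: regularization and the decomposition `W = R + ξ h` -/

/-- A Brownian motion agrees almost surely, at all times, with a process all of whose paths are
continuous and all of whose marginals are measurable. -/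
lemma ProbabilityTheory.IsBrownianReal.exists_continuous_measurable {Ω : Type*}
    [MeasurableSpace Ω] {P : Measure Ω} {W : ℝ≥0 → Ω → ℝ} (hW : IsBrownianReal W P) :
    ∃ W' : ℝ≥0 → Ω → ℝ, (∀ t, Measurable (W' t)) ∧ (∀ ω, Continuous fun t => W' t ω) ∧
      ∀ᵐ ω ∂P, ∀ t, W t ω = W' t ω := by
  -- Outside one measurable null set the paths are continuous and agree with measurable versions at
  -- a dense sequence of times. Setting the process to 0 on that set keeps continuity, and limits
  -- along the sequence give measurability at every time.
  set d := TopologicalSpace.denseSeq ℝ≥0 with hd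
  have hmk := fun t => hW.aemeasurable t
  have hae : ∀ᵐ ω ∂P, (Continuous fun t => W t ω) ∧
      ∀ n, W (d n) ω = (hmk (d n)).mk (W (d n)) ω :=
    hW.cont.and (ae_all_iff.2 fun n => (hmk (d n)).ae_eq_mk)
  obtain ⟨N, hN, hNm, hN0⟩ := exists_measurable_superset_of_null (ae_iff.1 hae)
  have hgood : ∀ ω, ω ∉ N → (Continuous fun t => W t ω) ∧
      ∀ n, W (d n) ω = (hmk (d n)).mk (W (d n)) ω := fun ω hω => by
    by_contra hcon
    exact hω (hN hcon)
  have hcont : ∀ ω, Continuous fun t => Nᶜ.indicator (W t) ω := by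
    intro ω
    by_cases hω : ω ∈ N
    · simpa [hω] using continuous_const
    · simpa [hω] using (hgood ω hω).1
  have hdm : ∀ n, Measurable (Nᶜ.indicator (W (d n))) := by
    intro n
    have h1 : Nᶜ.indicator (W (d n)) = Nᶜ.indicator ((hmk (d n)).mk (W (d n))) := by
      ext ω
      by_cases hω : ω ∈ N
      · simp [hω]
      · simpa [hω] using (hgood ω hω).2 n
    rw [h1]
    exact (hmk (d n)).measurable_mk.indicator hNm.compl
  refine ⟨fun t => Nᶜ.indicator (W t), fun t => ?_, hcont, ?_⟩
  · obtain ⟨x, hx, hxt⟩ := mem_closure_iff_seq_limit.1 (TopologicalSpace.denseRange_denseSeq ℝ≥0 t)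
    refine measurable_of_tendsto_metrizable (f := fun n => Nᶜ.indicator (W (x n))) (fun n => ?_)
      (tendsto_pi_nhds.2 fun ω => ((hcont ω).tendsto t).comp hxt)
    obtain ⟨k, hk⟩ := hx n
    rw [← hk]
    exact hdm k
  · filter_upwards [measure_eq_zero_iff_ae_notMem.1 hN0] with ω hω t
    simp [hω]

/-- The space of continuous real paths, with the σ-algebra generated by the evaluations. -/
abbrev ContinuousPath : Type := {f : ℝ≥0 → ℝ // Continuous f}

/-- The part of `W` that is independent of `W θ`. -/
noncomputable def bridgePart {Ω : Type*} (W : ℝ≥0 → Ω → ℝ) (θ t : ℝ≥0) (ω : Ω) : ℝ :=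
  W t ω - ((min t θ : ℝ≥0) : ℝ) / θ * W θ ω

section Bridge

variable {Ω : Type*} [MeasurableSpace Ω] {P : Measure Ω} {W : ℝ≥0 → Ω → ℝ} {θ : ℝ≥0}

/-- Every member is a linear combination of at most two values of W. Joint Gaussianity with W θ is
what turns zero covariance into independence. -/
lemma ProbabilityTheory.IsPreBrownianReal.isGaussianProcess_bridgePart
    (hW : IsPreBrownianReal W P) :
    IsGaussianProcess (Sum.elim (fun _ : Unit => W θ) (bridgePart W θ)) P := by
  refine hW.isGaussianProcess.of_isGaussianProcess ?_
  rintro (_ | t)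
  · exact ⟨{θ},
      { toFun x := x ⟨θ, by simp⟩
        map_add' x y := by simp
        map_smul' c x := by simp }, by simp⟩
  · exact ⟨{t, θ},
      { toFun x := x ⟨t, by simp⟩ - ((min t θ : ℝ≥0) : ℝ) / θ * x ⟨θ, by simp⟩
        map_add' x y := by simp; ring
        map_smul' c x := by simp; ring }, by simp [bridgePart]⟩

lemma ProbabilityTheory.IsPreBrownianReal.hasGaussianLaw_bridgePart
    (hW : IsPreBrownianReal W P) (t : ℝ≥0) : HasGaussianLaw (bridgePart W θ t) P :=
  (hW.isGaussianProcess_bridgePart (θ := θ)).hasGaussianLaw_eval (Sum.inr t)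

lemma ProbabilityTheory.IsPreBrownianReal.covariance_bridgePart (hW : IsPreBrownianReal W P)
    (r t : ℝ≥0) :
    cov[bridgePart W θ t, W r; P] =
      ((min t r : ℝ≥0) : ℝ) - ((min t θ : ℝ≥0) : ℝ) / θ * ((min θ r : ℝ≥0) : ℝ) := by
  have := hW.isGaussianProcess.isProbabilityMeasure
  have hm := fun t => (hW.isGaussianProcess.hasGaussianLaw_eval t).memLp_two
  have hb : bridgePart W θ t = fun ω => W t ω - ((min t θ : ℝ≥0) : ℝ) / θ * W θ ω := rfl
  rw [hb, covariance_fun_sub_left (hm t) ((hm θ).const_mul _) (hm r),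
    covariance_const_mul_left, hW.covariance_eval, hW.covariance_eval]

lemma ProbabilityTheory.IsPreBrownianReal.indepFun_bridgePart (hW : IsPreBrownianReal W P)
    (hθ : 0 < θ) : IndepFun (W θ) (fun ω t => bridgePart W θ t ω) P := by
  have h1 := (hW.isGaussianProcess_bridgePart (θ := θ)).indepFun_of_covariance_eq_zero
    (fun _ => hW.aemeasurable θ) (fun t => (hW.hasGaussianLaw_bridgePart t).aemeasurable)
    fun _ t => by
      rw [covariance_comm, hW.covariance_bridgePart, min_self,
        div_mul_cancel₀ _ (NNReal.coe_ne_zero.2 hθ.ne'), sub_self]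
  exact h1.comp (φ := fun x : Unit → ℝ => x ()) (ψ := id) (measurable_pi_apply ()) measurable_id

/-- The variance equals t - min(t, θ)²/θ, since the bridge part is uncorrelated with W θ. -/
lemma ProbabilityTheory.IsPreBrownianReal.variance_bridgePart_le (hW : IsPreBrownianReal W P)
    (hθ : 0 < θ) (t : ℝ≥0) : Var[bridgePart W θ t; P] ≤ t := by
  have := hW.isGaussianProcess.isProbabilityMeasure
  have hm := fun t => (hW.isGaussianProcess.hasGaussianLaw_eval t).memLp_two
  have hb : bridgePart W θ t = fun ω => W t ω - ((min t θ : ℝ≥0) : ℝ) / θ * W θ ω := rfl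
  have hbm : MemLp (bridgePart W θ t) 2 P := (hW.hasGaussianLaw_bridgePart t).memLp_two
  rw [← covariance_self hbm.aemeasurable]
  nth_rw 2 [hb]
  rw [covariance_fun_sub_right hbm (hm t) ((hm θ).const_mul _), covariance_const_mul_right,
    hW.covariance_bridgePart, hW.covariance_bridgePart, min_self, min_self,
    div_mul_cancel₀ _ (NNReal.coe_ne_zero.2 hθ.ne'), sub_self, mul_zero, sub_zero]
  have : 0 ≤ ((min t θ : ℝ≥0) : ℝ) / θ * ((min θ t : ℝ≥0) : ℝ) := by positivity
  linarith

lemma ProbabilityTheory.IsPreBrownianReal.lintegral_exp_bridgePart_le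
    (hW : IsPreBrownianReal W P) (hθ : 0 < θ) (t : ℝ≥0) (b : ℝ) :
    ∫⁻ ω, ENNReal.ofReal (Real.exp (b * bridgePart W θ t ω)) ∂P ≤
      ENNReal.ofReal (Real.exp (b ^ 2 * t / 2)) := by
  have := hW.isGaussianProcess.isProbabilityMeasure
  have hm := fun t => (hW.isGaussianProcess.hasGaussianLaw_eval t).integrable
  have hlaw := (hW.hasGaussianLaw_bridgePart (θ := θ) t).map_eq_gaussianReal
  have hmean : ∫ ω, bridgePart W θ t ω ∂P = 0 := by
    simp only [bridgePart]
    rw [integral_sub (hm t) ((hm θ).const_mul _), integral_const_mul, hW.integral_eval,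
      hW.integral_eval]
    simp
  rw [hmean] at hlaw
  have hmeas : AEMeasurable (bridgePart W θ t) P := (hW.hasGaussianLaw_bridgePart t).aemeasurable
  have hint : Integrable (fun ω => Real.exp (b * bridgePart W θ t ω)) P := by
    have := integrable_exp_mul_gaussianReal (μ := 0) (v := Var[bridgePart W θ t; P].toNNReal) b
    rw [← hlaw] at this
    exact this.comp_aemeasurable hmeas
  rw [← ofReal_integral_eq_lintegral_ofReal hint
    (Filter.Eventually.of_forall fun ω => (Real.exp_pos _).le)]
  refine ENNReal.ofReal_le_ofReal ?_
  have hmgf := mgf_gaussianReal hlaw b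
  rw [mgf] at hmgf
  rw [hmgf, Real.coe_toNNReal _ (variance_nonneg _ _)]
  refine Real.exp_le_exp.2 ?_
  have := mul_le_mul_of_nonneg_right (hW.variance_bridgePart_le hθ t) (sq_nonneg b)
  linarith

/-- The log-integrand of the exponential functional along a path. -/
noncomputable def pathLogIntegrand (σ u : ℝ) (f : ContinuousPath) : ℝ :=
  σ * f.1 u.toNNReal - σ ^ 2 * u / 2

lemma measurable_pathLogIntegrand (σ u : ℝ) : Measurable (pathLogIntegrand σ u) := by
  have h1 : Measurable fun f : ContinuousPath => f.1 u.toNNReal :=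
    (measurable_pi_apply (X := fun _ : ℝ≥0 => ℝ) u.toNNReal).comp measurable_subtype_coe
  exact (h1.const_mul σ).sub_const _

/-- The direction along which the Gaussian variable `W θ / √θ` moves `σ W`. -/
noncomputable def brownianTilt (σ : ℝ) (θ : ℝ≥0) (u : ℝ) : ℝ :=
  σ * ((min u.toNNReal θ : ℝ≥0) : ℝ) / √θ

lemma isTilt_brownianTilt {σ : ℝ} (hσ : 0 < σ) (hθ : 0 < θ) :
    IsTilt (brownianTilt σ θ) (σ * √θ) where
  continuous := by
    unfold brownianTilt
    fun_prop
  nonneg u _ := by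
    unfold brownianTilt
    positivity
  pos u hu := by
    have h1 : 0 < min u.toNNReal θ := lt_min (Real.toNNReal_pos.2 hu) hθ
    have h2 : (0 : ℝ) < ((min u.toNNReal θ : ℝ≥0) : ℝ) := h1
    have h3 : (0 : ℝ) < √θ := Real.sqrt_pos.2 hθ
    unfold brownianTilt
    positivity
  le u := by
    have h3 : (0 : ℝ) < √θ := Real.sqrt_pos.2 hθ
    have h1 : ((min u.toNNReal θ : ℝ≥0) : ℝ) ≤ θ := NNReal.coe_le_coe.2 (min_le_right _ _)
    rw [brownianTilt, div_le_iff₀ h3, mul_assoc, Real.mul_self_sqrt θ.coe_nonneg]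
    gcongr

lemma integral_brownianTilt {σ : ℝ} :
    ∫ u in (0 : ℝ)..θ, brownianTilt σ θ u = σ * (θ : ℝ) ^ 2 / (2 * √θ) := by
  have h1 : Set.EqOn (brownianTilt σ θ) (fun u => σ / √θ * u) (Set.uIcc 0 (θ : ℝ)) := by
    intro u hu
    rw [Set.uIcc_of_le θ.coe_nonneg] at hu
    have h2 : u.toNNReal ≤ θ := Real.toNNReal_le_iff_le_coe.2 hu.2
    rw [brownianTilt, min_eq_left h2, Real.coe_toNNReal _ hu.1]
    ring
  rw [intervalIntegral.integral_congr h1, intervalIntegral.integral_const_mul, integral_id]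
  ring

/-- The path of the bridge part of a continuous process. -/
noncomputable def bridgePath (W : ℝ≥0 → Ω → ℝ) (θ : ℝ≥0) (hc : ∀ ω, Continuous fun t => W t ω)
    (ω : Ω) : ContinuousPath :=
  ⟨fun t => bridgePart W θ t ω, by
    have := hc ω
    unfold bridgePart
    fun_prop⟩

lemma measurable_bridgePart (hm : ∀ t, Measurable (W t)) (t : ℝ≥0) :
    Measurable (bridgePart W θ t) :=
  (hm t).sub ((hm θ).const_mul _)

lemma measurable_bridgePath (hm : ∀ t, Measurable (W t)) (hc : ∀ ω, Continuous fun t => W t ω) :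
    Measurable (bridgePath W θ hc) :=
  (measurable_pi_lambda _ fun t => measurable_bridgePart hm t).subtype_mk

lemma ProbabilityTheory.IsPreBrownianReal.hasExpMoments (hW : IsPreBrownianReal W P)
    (hm : ∀ t, Measurable (W t)) (hc : ∀ ω, Continuous fun t => W t ω) (hθ : 0 < θ) (σ v : ℝ) :
    HasExpMoments (pathLogIntegrand σ) (σ ^ 2) v (P.map (bridgePath W θ hc)) where
  continuous f := by
    have := f.2
    unfold pathLogIntegrand
    fun_prop
  measurable := measurable_pathLogIntegrand σ
  lintegral_le u hu _ a := by
    have hmeas : Measurable fun f : ContinuousPath =>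
        ENNReal.ofReal (Real.exp (a * pathLogIntegrand σ u f)) :=
      ((measurable_pathLogIntegrand σ u).const_mul a).exp.ennreal_ofReal
    rw [lintegral_map hmeas (measurable_bridgePath hm hc)]
    have h1 : ∀ ω, ENNReal.ofReal
        (Real.exp (a * pathLogIntegrand σ u (bridgePath W θ hc ω))) =
        ENNReal.ofReal (Real.exp (-(a * σ ^ 2 * u / 2))) *
          ENNReal.ofReal (Real.exp ((a * σ) * bridgePart W θ u.toNNReal ω)) := by
      intro ω
      rw [← ENNReal.ofReal_mul (Real.exp_pos _).le, ← Real.exp_add]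
      congr 2
      simp only [pathLogIntegrand, bridgePath]
      ring
    simp_rw [h1]
    rw [lintegral_const_mul' _ _ ENNReal.ofReal_ne_top]
    refine (mul_le_mul_right (hW.lintegral_exp_bridgePart_le hθ u.toNNReal (a * σ)) _).trans ?_
    rw [← ENNReal.ofReal_mul (Real.exp_pos _).le, ← Real.exp_add, Real.coe_toNNReal _ hu]
    refine ENNReal.ofReal_le_ofReal (Real.exp_le_exp.2 (le_of_eq ?_))
    ring

lemma ProbabilityTheory.IsPreBrownianReal.map_prodMk_bridgePath (hW : IsPreBrownianReal W P)
    (hm : ∀ t, Measurable (W t)) (hc : ∀ ω, Continuous fun t => W t ω) (hθ : 0 < θ) :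
    P.map (fun ω => (W θ ω / √θ, bridgePath W θ hc ω)) =
      (gaussianReal 0 1).prod (P.map (bridgePath W θ hc)) := by
  have := hW.isGaussianProcess.isProbabilityMeasure
  have hlaw : P.map (fun ω => W θ ω / √θ) = gaussianReal 0 1 := by
    have h1 := gaussianReal_div_const (hW.hasLaw_eval θ) (√θ)
    rw [h1.map_eq]
    congr 1
    · simp
    · ext
      have h2 : (θ : ℝ) ≠ 0 := NNReal.coe_ne_zero.2 hθ.ne'
      simp [h2]
  have hind : IndepFun (W θ) (bridgePath W θ hc) P := by
    have h1 := hW.indepFun_bridgePart hθ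
    rw [IndepFun_iff_Indep] at h1 ⊢
    -- The σ-algebra on paths is pulled back from the product, so independence of the path is
    -- independence of the family of its values.
    rwa [Subtype.instMeasurableSpace, MeasurableSpace.comap_comp]
  have hind' : IndepFun (fun ω => W θ ω / √θ) (bridgePath W θ hc) P :=
    hind.comp (φ := fun x : ℝ => x / √θ) (ψ := id) (measurable_id.div_const _) measurable_id
  rw [← hlaw]
  exact (indepFun_iff_map_prod_eq_prod_map_map ((hm θ).div_const _).aemeasurable
    (measurable_bridgePath hm hc).aemeasurable).1 hind'

end Bridge

/-- Writing θ = √θ √θ in the coefficient of W θ makes the normalised variable W θ / √θ the argument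
of the tilt. -/
lemma expFunctional_eq_tiltMoment {Ω : Type*} {W : ℝ≥0 → Ω → ℝ} {θ : ℝ≥0}
    (hc : ∀ ω, Continuous fun t => W t ω) (σ v : ℝ)
    (ω : Ω) :
    expFunctional σ W v ω = tiltMoment (brownianTilt σ θ)
      (fun u => pathLogIntegrand σ u (bridgePath W θ hc ω)) v 0 (W θ ω / √θ) := by
  refine intervalIntegral.integral_congr fun u _ => ?_
  simp only [pathLogIntegrand, bridgePath, bridgePart, brownianTilt, pow_zero, one_mul]
  rw [div_mul_div_comm, Real.mul_self_sqrt θ.coe_nonneg]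
  congr 1
  ring

/-! ### The density of the exponential functional -/

lemma logTail_of_le {κ σ v z : ℝ} (hz : z ≤ v) : logTail κ σ v z = 1 := by
  simp [logTail, hz]

lemma logTail_of_lt {κ σ v z : ℝ} (hz : v < z) :
    logTail κ σ v z = Real.exp (-(κ / (σ ^ 2 * v)) * (Real.log (z / v)) ^ 2) := by
  simp [logTail, hz]

lemma logTail_nonneg (κ σ v z : ℝ) : 0 ≤ logTail κ σ v z :=
  add_nonneg (Set.indicator_nonneg (fun _ _ => (Real.exp_pos _).le) _)
    (Set.indicator_nonneg (fun _ _ => zero_le_one) _)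

/-- The density of the exponential functional of a Brownian motion and its bounds, in terms of
the time horizon `θ` of the conditioning. -/
theorem ProbabilityTheory.IsBrownianReal.exists_isDensityOnPos_expFunctional {Ω : Type*}
    [MeasurableSpace Ω] {P : Measure Ω} {W : ℝ≥0 → Ω → ℝ} (hW : IsBrownianReal W P) {σ v : ℝ}
    (hσ : 0 < σ) {θ : ℝ≥0} (hθ : 0 < θ) (hθv : θ ≤ v) (hσθ : σ ^ 2 * θ ≤ 1) :
    ∃ q : ℝ → ℝ, IsDensityOnPos P (expFunctional σ W v) q ∧ ∀ z : ℝ, 0 < z →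
      DifferentiableAt ℝ q z ∧
      q z ≤ Real.exp 20 * (σ * (θ : ℝ) ^ 2 / (2 * √θ))⁻¹ * logTail (1 / 16) σ v z ∧
      |deriv q z| ≤
        Real.exp 20 * (σ * (θ : ℝ) ^ 2 / (2 * √θ))⁻¹ ^ 2 * logTail (1 / 16) σ v z := by
  obtain ⟨W', hm, hc, hae⟩ := hW.exists_continuous_measurable
  have hW' : IsPreBrownianReal W' P := hW.toIsPreBrownianReal.congr fun t => by
    filter_upwards [hae] with ω hω using hω t
  have := hW'.isGaussianProcess.isProbabilityMeasure
  have hpath : Measurable (bridgePath W' θ hc) := measurable_bridgePath hm hc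
  have := Measure.isProbabilityMeasure_map (μ := P) hpath.aemeasurable
  set Q := P.map (bridgePath W' θ hc) with hQ
  have hθ0 : (0 : ℝ) < θ := hθ
  have hv : 0 < v := hθ0.trans_le hθv
  have hT : 0 < σ ^ 2 := by positivity
  have hG : HasExpMoments (pathLogIntegrand σ) (σ ^ 2) v Q := hW'.hasExpMoments hm hc hθ σ v
  have hh := isTilt_brownianTilt hσ hθ
  have hsq : (σ * √θ) ^ 2 = σ ^ 2 * θ := by rw [mul_pow, Real.sq_sqrt θ.coe_nonneg]
  have hs : σ * √θ ≤ 1 := by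
    rw [← sq_le_one_iff₀ (by positivity), hsq]
    exact hσθ
  have hsT : (σ * √θ) ^ 2 ≤ σ ^ 2 * v := by
    rw [hsq]
    gcongr
  refine ⟨averagedTiltDensity (brownianTilt σ θ) (pathLogIntegrand σ) v Q, ⟨?_, ?_, ?_⟩, ?_⟩
  · exact (hh.measurable_averagedTiltDensity hs hv hG.continuous hG.measurable).aemeasurable
  · exact fun z _ => hh.averagedTiltDensity_nonneg hv hG.continuous z
  · have hM := hh.measurable_tiltMoment hv hG.continuous hG.measurable 0
    have hpair : Measurable fun ω => (W' θ ω / √θ, bridgePath W' θ hc ω) :=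
      ((hm θ).div_const _).prodMk hpath
    have hlaw : HasLaw ((fun p : ℝ × ContinuousPath => tiltMoment (brownianTilt σ θ)
        (fun u => pathLogIntegrand σ u p.2) v 0 p.1) ∘
          fun ω => (W' θ ω / √θ, bridgePath W' θ hc ω))
        ((volume.restrict (Set.Ioi 0)).withDensity fun z => ENNReal.ofReal
          (averagedTiltDensity (brownianTilt σ θ) (pathLogIntegrand σ) v Q z)) P := by
      refine ⟨(hM.comp hpair).aemeasurable, ?_⟩
      rw [← Measure.map_map hM hpair, hW'.map_prodMk_bridgePath hm hc hθ,
        hG.map_tiltMoment_eq hh hs hsT hT hθ0 hθv hσθ]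
    refine hlaw.congr ?_
    filter_upwards [hae] with ω hω
    rw [Function.comp_apply, ← expFunctional_eq_tiltMoment hc σ v ω]
    simp only [expFunctional, hω]
  · intro z hz
    have h1 := hG.averagedTiltDensity_bounds hh hs hsT hT hθ0 hθv hσθ hz
      (L := logTail (1 / 16) σ v z) logTail_of_le fun hvz => by
        rw [logTail_of_lt hvz]
        congr 1
        field_simp
    rw [integral_brownianTilt] at h1
    exact h1.2

/-! ### Choice of the horizon and of the constants -/

theorem mainTheorem4 :
    ∃ c κ : ℝ, 0 < c ∧ 0 < κ ∧
      ∃ C : ℝ → ℝ, (∀ σ : ℝ, 0 < σ → 0 < C σ) ∧ (∀ σ : ℝ, 1 ≤ σ → C σ = c) ∧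
        ∀ (Ω : Type*) [MeasurableSpace Ω] (P : Measure Ω) [IsProbabilityMeasure P]
          (W : ℝ≥0 → Ω → ℝ), IsBrownianReal W P →
          ∀ σ : ℝ, 0 < σ → ∀ v : ℝ, 0 < v → v ≤ 1 →
            ∃ q : ℝ → ℝ, IsDensityOnPos P (expFunctional σ W v) q ∧
              ∀ z : ℝ, 0 < z →
                DifferentiableAt ℝ q z ∧
                q z ≤ c * σ ^ 3 / vStar σ v ^ 2 * logTail κ σ v z ∧
                |deriv q z| ≤ C σ * σ ^ 7 / vStar σ v ^ 4 * logTail κ σ v z := by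
  refine ⟨4 * Real.exp 20, 1 / 16, by positivity, by norm_num,
    -- H⁻² produces σ⁶ rather than σ⁷; the missing factor σ is free for σ ≥ 1 and costs σ⁻¹ below 1.
    fun σ => 4 * Real.exp 20 * max 1 σ⁻¹, fun σ hσ => by positivity, fun σ hσ => ?_, ?_⟩
  · simp only []
    rw [max_eq_left (inv_le_one_of_one_le₀ hσ), mul_one]
  intro Ω _ P _ W hW σ hσ v hv hv1
  have hσ2 : 0 < σ ^ 2 := by positivity
  -- The largest horizon with θ ≤ v and σ²θ ≤ 1, hence the largest H.
  obtain ⟨θ, hθ⟩ : ∃ θ : ℝ≥0, (θ : ℝ) = min v (σ ^ 2)⁻¹ :=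
    ⟨⟨min v (σ ^ 2)⁻¹, by positivity⟩, rfl⟩
  have hθ0 : (0 : ℝ) < θ := by rw [hθ]; positivity
  have hθv : (θ : ℝ) ≤ v := hθ ▸ min_le_left _ _
  have hstar : vStar σ v = σ ^ 2 * θ := by
    rw [vStar, hθ, mul_min_of_nonneg _ _ hσ2.le, mul_inv_cancel₀ hσ2.ne']
  have hσθ : σ ^ 2 * θ ≤ 1 := by
    rw [← hstar]
    exact min_le_right _ _
  obtain ⟨q, hq, hbound⟩ := hW.exists_isDensityOnPos_expFunctional hσ hθ0 hθv hσθ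
  refine ⟨q, hq, fun z hz => ?_⟩
  obtain ⟨hdiff, hle, hderiv⟩ := hbound z hz
  have hL := logTail_nonneg (1 / 16) σ v z
  obtain ⟨r, hr⟩ : ∃ r, r = √(θ : ℝ) := ⟨_, rfl⟩
  have hr0 : 0 < r := hr ▸ Real.sqrt_pos.2 hθ0
  have hrθ : (θ : ℝ) = r ^ 2 := by rw [hr, Real.sq_sqrt θ.coe_nonneg]
  have hr1 : r ≤ 1 := by
    rw [hr]
    exact Real.sqrt_le_one.2 (hθv.trans hv1)
  -- H⁻¹ = 2σ⁻¹θ^(-3/2), rewritten with (σ²θ)² in the denominator. The surplus factor r = √θ ≤ 1 is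
  -- discarded afterwards.
  have hinv : (σ * (θ : ℝ) ^ 2 / (2 * √θ))⁻¹ = 2 * r * σ ^ 3 / vStar σ v ^ 2 := by
    rw [hstar, ← hr, hrθ]
    field_simp
  have hS : 0 < vStar σ v := by rw [hstar]; positivity
  rw [hinv] at hle hderiv
  refine ⟨hdiff, hle.trans (mul_le_mul_of_nonneg_right ?_ hL),
    hderiv.trans (mul_le_mul_of_nonneg_right ?_ hL)⟩
  · rw [← mul_div_assoc]
    refine div_le_div_of_nonneg_right ?_ (by positivity)
    have h1 : 0 < Real.exp 20 * σ ^ 3 := by positivity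
    nlinarith
  · rw [div_pow, ← mul_div_assoc, ← pow_mul]
    refine div_le_div_of_nonneg_right ?_ (by positivity)
    have h1 : 1 ≤ max 1 σ⁻¹ * σ := by
      calc 1 = σ⁻¹ * σ := (inv_mul_cancel₀ hσ.ne').symm
        _ ≤ max 1 σ⁻¹ * σ := by
          gcongr
          exact le_max_right _ _
    have h2 : r ^ 2 ≤ 1 := pow_le_one₀ hr0.le hr1
    have h3 : 0 < 4 * Real.exp 20 * σ ^ 6 := by positivity
    calc Real.exp 20 * (2 * r * σ ^ 3) ^ 2 = 4 * Real.exp 20 * σ ^ 6 * r ^ 2 := by ring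
      _ ≤ 4 * Real.exp 20 * σ ^ 6 * (max 1 σ⁻¹ * σ) := by
        gcongr
        exact h2.trans h1
      _ = 4 * Real.exp 20 * max 1 σ⁻¹ * σ ^ 7 := by ring
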